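/- Let $n\ge 0$ be an integer, $T>0$, and let $Q$ be a real orthogonal $n\times n$ matrix with complex eigenvalues $e^{i\theta_1},\dots,e^{i\theta_n}$, $0\le\theta_p<2\pi$. Let $$X=\{x\in H^1([0,T],\mathbf R^n): x(t+T)=Qx(t)\text{ for all }t\in\mathbf R\},\qquad \langle x,y\rangle=\int_0^T\big((x,y)+(x',y')\big)\,dt,$$ with the action $(\mathcal Q(s)x)(t)=x(t+s)$, $s\in\mathbf R$. Write $\mathrm{Fix}=\{x\in X:\mathcal Q(s)x=x\ \forall s\}$ and $\hat X=\{x\in X:\lim_{t\to\infty}\frac1t\int_0^t x(s)\,ds=0\}$. A set $\Gamma\subset X$ is invariant if $\mathcal Q(s)\Gamma\subset\Gamma$ for all $s$. For invariant $\Gamma$, the $\mathcal Q(s)$ index $\mathrm{ind}\,\Gamma\in\mathbf N\cup\{\infty\}$ is the smallest $k$ for which there is a continuous map $\Phi=(\Phi_1,\dots,\Phi_k):\Gamma\to\mathbf C^k\setminus\{0\}$ such that for each $l$ there are $m_l\in\mathbf Z$ and $1\le p_l\le n$ with $2\pi m_l+\theta_{p_l}\ne0$ and $$\Phi_l(\mathcal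 Q(s)x)=e^{i\frac{2\pi m_l+\theta_{p_l}}{T}s}\,\Phi_l(x)\qquad\forall s\in\mathbf R,\ x\in\Gamma;$$ it is $\infty$ if no such $k$ exists, and $\mathrm{ind}\,\emptyset=0$. Let $\mathfrak B$ be the class of all homeomorphisms $h:X\to X$ such that (a) $h$ is equivariant and $h(0)=0$; (b) for every finite dimensional invariant subspace $Y\subset X$, every compact $\Gamma\subset Y$ and every $\varepsilon>0$ there are a finite dimensional invariant subspace $Z\supset Y$ and an equivariant homeomorphism $\tilde h:Z\to Z$ with $\|h(z)-\tilde h(z)\|\le\varepsilon$ for all $z\in\Gamma$. For $j\ge1$ let $$\mathcal A_j=\{A\subset X: A\text{ is invariant and }\mathrm{ind}(h(A)\cap\hat X)\ge j\text{ for all }h\in\mathfrak B\},\qquad c_j=\inf_{A\in\mathcal A_j}\sup_A E\in[-\infty,+\infty].$$ **Theorem.** Let $E\in C^1(X,\mathbf R)$ be invariant, $E(\mathcal Q(s)x)=E(x)$ for all $s$ and $x$, and satisfy the Palais–Smale condition: every sequence $(x_k)$ in $X$ with $E(x_k)$ bounded and $E'(x_k)\to0$ has a convergent subsequence. For $c\in\mathbf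 R$ put $K_c=\{x\in X:E'(x)=0,\ E(x)=c\}$. Let $j\ge1$ and suppose that $-\infty<c_j<+\infty$, that $K_{c_j}\cap\mathrm{Fix}=\emptyset$, and that $c_j\ne E(0)$. Then $c_j$ is a critical value of $E$. Moreover, if $c_i=c_j$ for some $1\le i\le j$, then $$\mathrm{ind}\,K_{c_i}\ge j-i+1 .$$ -/

import Mathlib

open MeasureTheory Filter Topology

noncomputable section

namespace RotatingOrbits

/-- `x : ℝ → ℝⁿ` is of Sobolev class `H¹` on every bounded interval: it is a primitive of a function
that is square integrable on every bounded interval. -/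
def IsH1Loc {n : ℕ} (x : ℝ → EuclideanSpace ℝ (Fin n)) : Prop :=
  ∃ g : ℝ → EuclideanSpace ℝ (Fin n),
    (∀ a b : ℝ, MemLp g 2 (volume.restrict (Set.Ioc a b))) ∧
      ∀ t, x t = x 0 + ∫ s in (0 : ℝ)..t, g s

theorem intervalIntegrable_of_memLp {n : ℕ} {g : ℝ → EuclideanSpace ℝ (Fin n)}
    (hg : ∀ a b : ℝ, MemLp g 2 (volume.restrict (Set.Ioc a b))) (a b : ℝ) :
    IntervalIntegrable g volume a b :=
  ⟨(hg a b).integrable (by norm_num), (hg b a).integrable (by norm_num)⟩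

theorem IsH1Loc.continuous {n : ℕ} {x : ℝ → EuclideanSpace ℝ (Fin n)} (hx : IsH1Loc x) :
    Continuous x := by
  obtain ⟨g, hg, h⟩ := hx
  rw [funext h]
  exact continuous_const.add
    (intervalIntegral.continuous_primitive (intervalIntegrable_of_memLp hg) 0)

theorem IsH1Loc.deriv_spec {n : ℕ} {x : ℝ → EuclideanSpace ℝ (Fin n)} (hx : IsH1Loc x) :
    (∀ᵐ t : ℝ, DifferentiableAt ℝ x t) ∧
      ∀ a b : ℝ, MemLp (deriv x) 2 (volume.restrict (Set.Ioc a b)) := by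
  obtain ⟨g, hg, h⟩ := hx
  have hloc : LocallyIntegrable g volume := by
    intro t
    refine ⟨Set.Ioc (t - 1) (t + 1), Ioc_mem_nhds (by linarith) (by linarith), ?_⟩
    exact (hg _ _).integrable (by norm_num)
  have hd : ∀ᵐ t : ℝ, HasDerivAt x (g t) t := by
    filter_upwards [LocallyIntegrable.ae_hasDerivAt_integral hloc] with t ht
    have := (ht 0).const_add (x 0)
    rwa [← funext h] at this
  refine ⟨hd.mono fun t ht => ht.differentiableAt, fun a b => ?_⟩
  refine (memLp_congr_ae ?_).2 (hg a b)
  exact ae_restrict_of_ae (hd.mono fun t ht => ht.deriv)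

/-- The functions `x : ℝ → ℝⁿ` with `x (t + T) = Q x (t)` for all `t` that are `H¹` on `[0, T]`
(equivalently, by the rotation relation, on every bounded interval). -/
def rotSubmodule (n : ℕ) (T : ℝ) (Q : Matrix.orthogonalGroup (Fin n) ℝ) :
    Submodule ℝ (ℝ → EuclideanSpace ℝ (Fin n)) where
  carrier := {x | IsH1Loc x ∧ ∀ t, x (t + T) = Matrix.toEuclideanLin Q.1 (x t)}
  add_mem' := by
    rintro x y ⟨⟨g, hg, hx⟩, hxT⟩ ⟨⟨k, hk, hy⟩, hyT⟩
    refine ⟨⟨g + k, fun a b => (hg a b).add (hk a b), fun t => ?_⟩, fun t => ?_⟩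
    · have : ∫ s in (0 : ℝ)..t, (g + k) s = (∫ s in (0 : ℝ)..t, g s) + ∫ s in (0 : ℝ)..t, k s :=
        intervalIntegral.integral_add (intervalIntegrable_of_memLp hg 0 t)
          (intervalIntegrable_of_memLp hk 0 t)
      rw [this, Pi.add_apply, Pi.add_apply, hx t, hy t]
      abel
    · rw [Pi.add_apply, Pi.add_apply, hxT, hyT, map_add]
  zero_mem' := ⟨⟨0, fun a b => MemLp.zero, fun t => by simp⟩, fun t => by simp⟩
  smul_mem' := by
    rintro c x ⟨⟨g, hg, hx⟩, hxT⟩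
    refine ⟨⟨c • g, fun a b => (hg a b).const_smul c, fun t => ?_⟩, fun t => ?_⟩
    · have : ∫ s in (0 : ℝ)..t, (c • g) s = c • ∫ s in (0 : ℝ)..t, g s :=
        intervalIntegral.integral_smul c g
      rw [this, Pi.smul_apply, Pi.smul_apply, hx t, smul_add]
    · rw [Pi.smul_apply, Pi.smul_apply, hxT, map_smul]

/-- The space `X` of rotating functions. Its topology is the one of the norm defined below. -/
def RotSpace (n : ℕ) (T : ℝ) (Q : Matrix.orthogonalGroup (Fin n) ℝ) : Type :=
  rotSubmodule n T Q

namespace RotSpace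

variable {n : ℕ} {T : ℝ} {Q : Matrix.orthogonalGroup (Fin n) ℝ}

instance : AddCommGroup (RotSpace n T Q) := inferInstanceAs (AddCommGroup (rotSubmodule n T Q))

instance : Module ℝ (RotSpace n T Q) := inferInstanceAs (Module ℝ (rotSubmodule n T Q))

/-- The elements of `X` are functions on `ℝ`. -/
instance : FunLike (RotSpace n T Q) ℝ (EuclideanSpace ℝ (Fin n)) where
  coe x := Subtype.val (p := fun f => f ∈ rotSubmodule n T Q) x
  coe_injective := Subtype.val_injective

theorem ext {x y : RotSpace n T Q} (h : ∀ t, x t = y t) : x = y := DFunLike.ext x y h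

theorem isH1Loc (x : RotSpace n T Q) : IsH1Loc x := x.2.1

theorem apply_add_period (x : RotSpace n T Q) (t : ℝ) :
    x (t + T) = Matrix.toEuclideanLin Q.1 (x t) := x.2.2 t

theorem coe_add (x y : RotSpace n T Q) : ⇑(x + y) = ⇑x + ⇑y := rfl

theorem coe_smul (c : ℝ) (x : RotSpace n T Q) : ⇑(c • x) = c • ⇑x := rfl

/-- The `H¹` inner product `∫₀ᵀ (x, y) + (x', y')`. -/
def h1Inner (x y : RotSpace n T Q) : ℝ :=
  ∫ t in (0 : ℝ)..T, (inner ℝ (x t) (y t) + inner ℝ (deriv x t) (deriv y t))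

theorem memLp_coe (x : RotSpace n T Q) (a b : ℝ) :
    MemLp x 2 (volume.restrict (Set.Ioc a b)) := by
  have hc := x.isH1Loc.continuous
  obtain ⟨C, hC⟩ := isCompact_Icc.exists_bound_of_continuousOn
    (s := Set.Icc a b) hc.continuousOn
  refine MemLp.of_bound hc.aestronglyMeasurable C ?_
  exact (ae_restrict_iff' measurableSet_Ioc).2
    (Eventually.of_forall fun t ht => hC t (Set.Ioc_subset_Icc_self ht))

theorem integrable_inner_of_memLp {f g : ℝ → EuclideanSpace ℝ (Fin n)} {μ : Measure ℝ}
    (hf : MemLp f 2 μ) (hg : MemLp g 2 μ) : Integrable (fun t => inner ℝ (f t) (g t)) μ := by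
  refine (hf.norm.integrable_mul hg.norm).mono'
    (hf.aestronglyMeasurable.inner hg.aestronglyMeasurable) ?_
  exact Eventually.of_forall fun t => norm_inner_le_norm _ _

theorem intervalIntegrable_h1 (x y : RotSpace n T Q) (a b : ℝ) :
    IntervalIntegrable
      (fun t => (inner ℝ (x t) (y t) + inner ℝ (deriv x t) (deriv y t) : ℝ)) volume a b := by
  constructor <;>
  exact (integrable_inner_of_memLp (x.memLp_coe _ _) (y.memLp_coe _ _)).add
    (integrable_inner_of_memLp (x.isH1Loc.deriv_spec.2 _ _) (y.isH1Loc.deriv_spec.2 _ _))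

theorem toEuclideanLin_injective (Q : Matrix.orthogonalGroup (Fin n) ℝ) :
    Function.Injective (Matrix.toEuclideanLin Q.1) := by
  have h : ∀ v, Matrix.toEuclideanLin (star Q.1) (Matrix.toEuclideanLin Q.1 v) = v := by
    intro v
    simp [Matrix.toLpLin_apply, Matrix.mulVec_mulVec]
  exact Function.LeftInverse.injective h

theorem eq_zero_of_Icc (hT : 0 < T) (x : RotSpace n T Q) (h : ∀ t ∈ Set.Icc 0 T, x t = 0) :
    x = 0 := by
  have hup : ∀ k : ℕ, ∀ t, x (t + k * T) = 0 ↔ x t = 0 := by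
    intro k
    induction k with
    | zero => intro t; simp
    | succ k ih =>
      intro t
      have : t + ((k + 1 : ℕ) : ℝ) * T = (t + k * T) + T := by push_cast; ring
      rw [this, apply_add_period, map_eq_zero_iff _ (toEuclideanLin_injective Q), ih]
  refine ext fun t => ?_
  change x t = 0
  have h0 : x (t - ⌊t / T⌋ * T) = 0 := by
    have h1 := Int.floor_le (t / T)
    have h2 := Int.lt_floor_add_one (t / T)
    rw [le_div_iff₀ hT] at h1
    rw [div_lt_iff₀ hT] at h2
    exact h _ ⟨by linarith, by linarith⟩
  obtain ⟨k, hk | hk⟩ := Int.eq_nat_or_neg ⌊t / T⌋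
  · have := (hup k (t - ⌊t / T⌋ * T)).2 h0
    rw [hk] at this
    simpa using this
  · rw [hk] at h0
    refine (hup k t).1 ?_
    have e : t - ((-(k : ℤ) : ℤ) : ℝ) * T = t + k * T := by push_cast; ring
    rwa [e] at h0

variable [hT : Fact (0 < T)]

theorem h1Inner_definite (x : RotSpace n T Q) (h : h1Inner x x = 0) : x = 0 := by
  refine eq_zero_of_Icc hT.out x ?_
  have hnn : 0 ≤ᵐ[volume.restrict (Set.Ioc 0 T)] fun t =>
      (inner ℝ (x t) (x t) + inner ℝ (deriv x t) (deriv x t) : ℝ) :=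
    Eventually.of_forall fun t => add_nonneg real_inner_self_nonneg real_inner_self_nonneg
  rw [h1Inner, intervalIntegral.integral_eq_zero_iff_of_le_of_nonneg_ae hT.out.le hnn
    (intervalIntegrable_h1 x x 0 T)] at h
  have hx : ⇑x =ᵐ[volume.restrict (Set.Ioc 0 T)] fun _ => 0 := by
    filter_upwards [h] with t ht
    have h1 : (0 : ℝ) ≤ inner ℝ (x t) (x t) := real_inner_self_nonneg
    have h2 : (0 : ℝ) ≤ inner ℝ (deriv x t) (deriv x t) := real_inner_self_nonneg
    have h3 : (inner ℝ (x t) (x t) + inner ℝ (deriv x t) (deriv x t) : ℝ) = 0 := ht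
    exact inner_self_eq_zero.1 (by linarith : (inner ℝ (x t) (x t) : ℝ) = 0)
  rw [Measure.restrict_congr_set Ioc_ae_eq_Icc] at hx
  exact Measure.eqOn_Icc_of_ae_eq volume hT.out.ne hx x.isH1Loc.continuous.continuousOn
    continuousOn_const

/-- The Hilbert space structure on `X` given by the `H¹` inner product. -/
@[reducible] def h1Core : InnerProductSpace.Core ℝ (RotSpace n T Q) where
  inner := h1Inner
  conj_inner_symm x y := by
    simp only [h1Inner, conj_trivial]
    refine intervalIntegral.integral_congr fun t _ => ?_
    simp only [real_inner_comm]
  re_inner_nonneg x := by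
    refine intervalIntegral.integral_nonneg hT.out.le fun t _ => ?_
    exact add_nonneg real_inner_self_nonneg real_inner_self_nonneg
  add_left x y z := by
    simp only [h1Inner]
    rw [← intervalIntegral.integral_add (intervalIntegrable_h1 x z 0 T)
      (intervalIntegrable_h1 y z 0 T)]
    refine intervalIntegral.integral_congr_ae ?_
    filter_upwards [x.isH1Loc.deriv_spec.1, y.isH1Loc.deriv_spec.1] with t hx hy _
    rw [coe_add, deriv_add hx hy, Pi.add_apply, inner_add_left, inner_add_left]
    ring
  smul_left x y r := by
    simp only [h1Inner, conj_trivial]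
    rw [← intervalIntegral.integral_const_mul]
    refine intervalIntegral.integral_congr_ae ?_
    filter_upwards [x.isH1Loc.deriv_spec.1] with t hx _
    rw [coe_smul, deriv_const_smul r hx, Pi.smul_apply, real_inner_smul_left, real_inner_smul_left]
    ring
  definite := h1Inner_definite

instance : NormedAddCommGroup (RotSpace n T Q) := h1Core.toNormedAddCommGroup

instance : InnerProductSpace ℝ (RotSpace n T Q) := InnerProductSpace.ofCore h1Core.toCore

end RotSpace

variable {n : ℕ} {T : ℝ} {Q : Matrix.orthogonalGroup (Fin n) ℝ}

/-- The action `(𝒬(s) x)(t) = x(t + s)`. -/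
def shift (s : ℝ) (x : RotSpace n T Q) : RotSpace n T Q :=
  ⟨fun t => x (t + s), by
    obtain ⟨g, hg, h⟩ := x.isH1Loc
    refine ⟨⟨fun t => g (t + s), fun a b => ?_, fun t => ?_⟩, fun t => ?_⟩
    · have hmp : MeasurePreserving (fun t : ℝ => t + s) (volume.restrict (Set.Ioc a b))
          (volume.restrict (Set.Ioc (a + s) (b + s))) := by
        have := (measurePreserving_add_right (volume : Measure ℝ) s).restrict_preimage
          (measurableSet_Ioc (a := a + s) (b := b + s))
        simpa using this
      exact (hg (a + s) (b + s)).comp_measurePreserving hmp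
    · have hi := intervalIntegrable_of_memLp hg
      change x (t + s) = x (0 + s) + ∫ r in (0 : ℝ)..t, g (r + s)
      rw [intervalIntegral.integral_comp_add_right, h (t + s), h (0 + s), zero_add, add_assoc,
        intervalIntegral.integral_add_adjacent_intervals (hi 0 s) (hi s (t + s))]
    · have := x.apply_add_period (t + s)
      change x (t + T + s) = Matrix.toEuclideanLin Q.1 (x (t + s))
      rwa [show t + s + T = t + T + s by ring] at this⟩

/-- `𝒬(s)` invariant subsets of `X`. -/
def IsInvariant (Γ : Set (RotSpace n T Q)) : Prop :=
  ∀ s : ℝ, ∀ x ∈ Γ, shift s x ∈ Γ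

variable (n T Q) in
/-- The fixed points of the action. -/
def fixedPoints : Set (RotSpace n T Q) := {x | ∀ s : ℝ, shift s x = x}

variable (n T Q) in
/-- `X̂`, the functions in `X` of mean value `0`. -/
def meanZero : Set (RotSpace n T Q) :=
  {x | Tendsto (fun t : ℝ => (1 / t) • ∫ s in (0 : ℝ)..t, x s) atTop (𝓝 0)}

/-- The numbers `(2 π m + θ) / T ≠ 0`, where `m ∈ ℤ` and `exp (i θ)`, `0 ≤ θ < 2 π`, is an
eigenvalue of `Q` over `ℂ`. -/
def frequencies (T : ℝ) (Q : Matrix.orthogonalGroup (Fin n) ℝ) : Set ℝ :=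
  {ω | ∃ (m : ℤ) (θ : ℝ), 0 ≤ θ ∧ θ < 2 * Real.pi ∧
    Module.End.HasEigenvalue (Matrix.toLin' (Q.1.map (fun r : ℝ => (r : ℂ))))
      (Complex.exp (Complex.I * θ)) ∧
    2 * Real.pi * m + θ ≠ 0 ∧ ω = (2 * Real.pi * m + θ) / T}

variable [Fact (0 < T)]

/-- There is a continuous `Φ : Γ → ℂᵏ \ {0}` each of whose coordinates is multiplied by
`exp (i ω s)`, for some frequency `ω` of that coordinate, when `𝒬(s)` acts on the argument.
(Blocks of coordinates with a common frequency are the same as a frequency for each coordinate.) -/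
def HasIndexMap (Γ : Set (RotSpace n T Q)) (k : ℕ) : Prop :=
  ∃ Φ : RotSpace n T Q → Fin k → ℂ, ContinuousOn Φ Γ ∧ (∀ x ∈ Γ, Φ x ≠ 0) ∧
    ∀ l : Fin k, ∃ ω ∈ frequencies T Q, ∀ s : ℝ, ∀ x ∈ Γ,
      Φ (shift s x) l = Complex.exp (Complex.I * ω * s) * Φ x l

/-- The `𝒬(s)` index: the least `k` admitting such a map, `⊤` if there is none. As `ℂ⁰ \ {0}` is
empty, it is `0` exactly for `Γ = ∅`. -/
def ind (Γ : Set (RotSpace n T Q)) : ℕ∞ :=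
  sInf {k : ℕ∞ | ∃ m : ℕ, k = m ∧ HasIndexMap Γ m}

variable (n T Q) in
/-- The class `𝔅` of equivariant homeomorphisms of `X` that fix `0` and can be approximated, on
compact subsets of finite dimensional invariant subspaces `Y`, by equivariant homeomorphisms of
finite dimensional invariant subspaces `Z ⊇ Y`. -/
def classB : Set (RotSpace n T Q ≃ₜ RotSpace n T Q) :=
  {h | (∀ s x, h (shift s x) = shift s (h x)) ∧ h 0 = 0 ∧
    ∀ (Y : Submodule ℝ (RotSpace n T Q)) (Γ : Set (RotSpace n T Q)) (ε : ℝ),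
      FiniteDimensional ℝ Y → IsInvariant (Y : Set (RotSpace n T Q)) →
      IsCompact Γ → Γ ⊆ Y → 0 < ε →
      ∃ (Z : Submodule ℝ (RotSpace n T Q)) (k : Z ≃ₜ Z),
        FiniteDimensional ℝ Z ∧ IsInvariant (Z : Set (RotSpace n T Q)) ∧ Y ≤ Z ∧
        (∀ (s : ℝ) (z w : Z), (w : RotSpace n T Q) = shift s z →
          (k w : RotSpace n T Q) = shift s (k z)) ∧
        ∀ z : Z, (z : RotSpace n T Q) ∈ Γ → ‖h z - k z‖ ≤ ε}

variable (n T Q) in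
/-- `𝒜ⱼ`: the invariant sets `A` with `ind (h(A) ∩ X̂) ≥ j` for all `h` in `𝔅`. -/
def classA (j : ℕ) : Set (Set (RotSpace n T Q)) :=
  {A | IsInvariant A ∧ ∀ h ∈ classB n T Q, (j : ℕ∞) ≤ ind (h '' A ∩ meanZero n T Q)}

/-- The minimax value `cⱼ = inf_{A ∈ 𝒜ⱼ} sup_A E`, in the extended reals. -/
def minimax (E : RotSpace n T Q → ℝ) (j : ℕ) : EReal :=
  ⨅ A ∈ classA n T Q j, ⨆ x ∈ A, (E x : EReal)

/-- The critical set `K_c`. -/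
def criticalSet (E : RotSpace n T Q → ℝ) (c : ℝ) : Set (RotSpace n T Q) :=
  {x | fderiv ℝ E x = 0 ∧ E x = c}

/-- The Palais-Smale condition. -/
def PalaisSmale (E : RotSpace n T Q → ℝ) : Prop :=
  ∀ u : ℕ → RotSpace n T Q, (∃ M : ℝ, ∀ k, |E (u k)| ≤ M) →
    Tendsto (fun k => fderiv ℝ E (u k)) atTop (𝓝 0) →
    ∃ (x : RotSpace n T Q) (φ : ℕ → ℕ), StrictMono φ ∧ Tendsto (u ∘ φ) atTop (𝓝 x)

end RotatingOrbits

end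

/-!
Suppose that `K = K_c`, with `c = c_j`, has an index map with `k ≤ j - i` coordinates. It is shown
that then `c_i < c` (`minimax_lt_of_hasIndexMap`). Both claims follow: the index of `K` is at least
`j - i + 1` if `c_i = c_j`, and the case `i = j`, `k = 0` says that `K` is not empty.

`K` is compact by the Palais-Smale condition. Its index map is approximated by an equivariant
*Lipschitz* map `Ψ` on the whole of `X` (`exists_lipschitz_rotatesOn`): extend by inf-convolution,
then average over the group. So `‖Ψ‖ ≥ 4m > 0` on `K`, and `E'` is bounded away from `0` on the set
`F` where `‖Ψ‖ ≤ 3m` and `E` is near `c`; as `E 0 ≠ c`, `F` can be taken to avoid `0`. Let `A` be a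
set in `𝒜_j` on which `E < c + ε`. A deformation `h` in `𝔅` of small speed pushes
`A' = A ∩ {‖Ψ‖ ≤ 2m}` below `c - ε`, and subadditivity of the index (`HasIndexMap.add`) puts `h(A')`
in `𝒜_i`: for `g ∈ 𝔅`, an index map on `g(h(A')) ∩ X̂` together with `Ψ ∘ (g ∘ h)⁻¹` is one on
`g(h(A)) ∩ X̂`, because `g ∘ h ∈ 𝔅`.

The deformation (`IsometryRep.exists_deformation`) is the flow of an equivariant pseudogradient
field that locally takes values in finite dimensional invariant subspaces. On a compact subset of
such a subspace it then coincides with the flow of the projected field on any larger invariant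
subspace, which is more than the approximation that `𝔅` asks for, and which makes `g ∘ h` a member
of `𝔅` (`trans_mem_classB`). The field is glued by a partition of unity on the space of orbits from
local fields, and these are equivariant Lipschitz approximations of the gradient projected to a
finite dimensional invariant subspace.

That such subspaces have dense union is a spectral theorem: the operator that represents the `L²`
inner product on `X` is compact, symmetric, injective and commutes with the action, so its
eigenspaces are finite dimensional, invariant and span a dense subspace
(`hasDenseFinInvariant_shiftRep`).
-/

open MeasureTheory Filter Topology

noncomputable section

namespace RotatingOrbits

/-! ### Flows of bounded locally Lipschitz vector fields -/

section Flows

variable {X : Type*} [NormedAddCommGroup X] [NormedSpace ℝ X] {V : X → X}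

/-- Near each point the integral curves exist for a common time and depend continuously on their
initial value. -/
theorem exists_local_flow [CompleteSpace X] (hV : LocallyLipschitz V) (x₀ : X) :
    ∃ r > 0, ∃ τ > 0, ∃ α : X → ℝ → X,
      (∀ x ∈ Metric.closedBall x₀ r, α x 0 = x ∧
        ∀ t ∈ Set.Ioo (-τ) τ, HasDerivAt (α x) (V (α x t)) t) ∧
      ∀ t ∈ Set.Ioo (-τ) τ, ContinuousOn (fun x => α x t) (Metric.closedBall x₀ r) := by
  obtain ⟨K, s, hs, hl⟩ := hV x₀
  obtain ⟨a, ha, has⟩ := Metric.nhds_basis_closedBall.mem_iff.1 hs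
  set L : ℝ := K * a + ‖V x₀‖ + 1 with hL
  have hL0 : 0 < L := by positivity
  have hb : ∀ x ∈ Metric.closedBall x₀ a, ‖V x‖ ≤ L := by
    intro x hx
    have h1 : ‖V x - V x₀‖ ≤ K * ‖x - x₀‖ := hl.norm_sub_le (has hx) (mem_of_mem_nhds hs)
    have h2 : ‖x - x₀‖ ≤ a := by simpa [dist_eq_norm] using hx
    have h3 : (K : ℝ) * ‖x - x₀‖ ≤ K * a := by gcongr
    have h4 := norm_le_norm_sub_add (V x) (V x₀)
    linarith
  set τ : ℝ := a / (2 * L) with hτ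
  have hτ0 : 0 < τ := by positivity
  have hpl : IsPicardLindelof (fun _ => V) (tmin := -τ) (tmax := τ)
      ⟨0, by constructor <;> linarith⟩ x₀ (.mk a ha.le) (.mk (a / 2) (half_pos ha).le)
      (.mk L hL0.le) K := by
    refine IsPicardLindelof.of_time_independent hb (hl.mono has) ?_
    simp only [NNReal.coe_mk, sub_zero, zero_sub, neg_neg, max_self]
    rw [hτ]
    field_simp
    norm_num
  obtain ⟨α, h1, L', h2⟩ := hpl.exists_forall_mem_closedBall_eq_hasDerivWithinAt_lipschitzOnWith
  refine ⟨a / 2, half_pos ha, τ, hτ0, α, fun x hx => ⟨(h1 x hx).1, fun t ht => ?_⟩, fun t ht => ?_⟩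
  · exact ((h1 x hx).2 t (Set.Ioo_subset_Icc_self ht)).hasDerivAt (Icc_mem_nhds ht.1 ht.2)
  · exact (h2 t (Set.Ioo_subset_Icc_self ht)).continuousOn

theorem integralCurve_eventuallyEq (hV : LocallyLipschitz V) {f g : ℝ → X} {t : ℝ}
    (hf : ∀ᶠ s in 𝓝 t, HasDerivAt f (V (f s)) s) (hg : ∀ᶠ s in 𝓝 t, HasDerivAt g (V (g s)) s)
    (h : f t = g t) : f =ᶠ[𝓝 t] g := by
  obtain ⟨K, u, hu, hl⟩ := hV (f t)
  have hft := hf.self_of_nhds.continuousAt.eventually_mem hu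
  have hgt := hg.self_of_nhds.continuousAt.eventually_mem (h ▸ hu)
  exact ODE_solution_unique_of_eventually (v := fun _ => V) (s := fun _ => u) (K := K)
    (Eventually.of_forall fun _ => hl) (hf.and hft) (hg.and hgt) h

/-- Uniqueness of integral curves, on open intervals. -/
theorem integralCurve_eqOn (hV : LocallyLipschitz V) {f g : ℝ → X} {U : Set ℝ} (hU : IsOpen U)
    (hUc : IsPreconnected U) (hf : ∀ s ∈ U, HasDerivAt f (V (f s)) s)
    (hg : ∀ s ∈ U, HasDerivAt g (V (g s)) s) {t₀ : ℝ} (ht₀ : t₀ ∈ U) (h : f t₀ = g t₀) :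
    Set.EqOn f g U := by
  have key : ∀ t ∈ U, f t = g t → f =ᶠ[𝓝 t] g := fun t ht h =>
    integralCurve_eventuallyEq hV (Filter.mem_of_superset (hU.mem_nhds ht) hf)
      (Filter.mem_of_superset (hU.mem_nhds ht) hg) h
  have hsub : U ⊆ {t | f =ᶠ[𝓝 t] g} := by
    refine hUc.subset_of_closure_inter_subset isOpen_setOfPred_eventually_nhds
      ⟨t₀, ht₀, key t₀ ht₀ h⟩ ?_
    rintro t ⟨htc, htU⟩
    refine key t htU ?_
    by_contra hne
    have h1 : ∀ᶠ s in 𝓝 t, f s ≠ g s :=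
      (hf t htU).continuousAt.ne_iff_eventually_ne (hg t htU).continuousAt |>.1 hne
    obtain ⟨s, hs1, hs2⟩ := (mem_closure_iff_frequently.1 htc).and_eventually h1 |>.exists
    exact hs2 hs1.self_of_nhds
  exact fun t ht => (hsub ht).self_of_nhds

/-- The integral curves of a bounded locally Lipschitz field are defined for all times: they are
Lipschitz, so that they converge at a finite end of their domain and can be continued there. -/
theorem exists_global_integralCurve [CompleteSpace X] (hV : LocallyLipschitz V) {M : ℝ}
    (hM : ∀ x, ‖V x‖ ≤ M) (x : X) :
    ∃ γ : ℝ → X, γ 0 = x ∧ ∀ t, HasDerivAt γ (V (γ t)) t := by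
  classical
  let Sol : Set ℝ → (ℝ → X) → Prop := fun U γ =>
    IsOpen U ∧ IsPreconnected U ∧ (0 : ℝ) ∈ U ∧ γ 0 = x ∧ ∀ t ∈ U, HasDerivAt γ (V (γ t)) t
  have hM0 : 0 ≤ M := (norm_nonneg _).trans (hM 0)
  -- The integral curves through `x` agree where they are both defined, and are glued to one on the
  -- union `D` of their domains; `D` turns out to be closed.
  have huniq : ∀ U γ U' γ', Sol U γ → Sol U' γ' → ∀ t ∈ U, t ∈ U' → γ t = γ' t := by
    rintro U γ U' γ' ⟨o, c, z, i, d⟩ ⟨o', c', z', i', d'⟩ t ht ht'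
    exact integralCurve_eqOn hV (o.inter o')
      ((c.ordConnected.inter c'.ordConnected).isPreconnected)
      (fun s hs => d s hs.1) (fun s hs => d' s hs.2) ⟨z, z'⟩ (i.trans i'.symm) ⟨ht, ht'⟩
  let D : Set ℝ := ⋃₀ {U | ∃ γ, Sol U γ}
  have hex : ∀ t ∈ D, ∃ γ U, t ∈ U ∧ Sol U γ := by
    rintro t ⟨U, ⟨γ, h⟩, ht⟩
    exact ⟨γ, U, ht, h⟩
  choose! c u hcu using hex
  let Γ : ℝ → X := fun t => c t t
  have hΓ : ∀ U γ, Sol U γ → ∀ t ∈ U, Γ t = γ t := by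
    intro U γ h t ht
    have := hcu t ⟨U, ⟨γ, h⟩, ht⟩
    exact huniq _ _ _ _ this.2 h t this.1 ht
  have hDo : IsOpen D := isOpen_sUnion fun U ⟨γ, h⟩ => h.1
  have h0D : (0 : ℝ) ∈ D := by
    obtain ⟨r, hr, τ, hτ, α, h1, -⟩ := exists_local_flow hV x
    obtain ⟨h2, h3⟩ := h1 x (Metric.mem_closedBall_self hr.le)
    exact ⟨Set.Ioo (-τ) τ, ⟨α x, isOpen_Ioo, isPreconnected_Ioo, by simp [hτ], h2, h3⟩,
      by simp [hτ]⟩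
  have hDc : IsPreconnected D :=
    isPreconnected_sUnion 0 _ (fun U ⟨γ, h⟩ => h.2.2.1) fun U ⟨γ, h⟩ => h.2.1
  have hΓd : ∀ t ∈ D, HasDerivAt Γ (V (Γ t)) t := by
    rintro t ⟨U, ⟨γ, h⟩, ht⟩
    rw [hΓ U γ h t ht]
    exact (h.2.2.2.2 t ht).congr_of_eventuallyEq
      (Filter.mem_of_superset (h.1.mem_nhds ht) fun s hs => hΓ U γ h s hs)
  have hΓ0 : Γ 0 = x := by
    obtain ⟨U, ⟨γ, h⟩, ht⟩ := h0D
    rw [hΓ U γ h 0 ht, h.2.2.2.1]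
  have hlip : LipschitzOnWith (.mk M hM0) Γ D :=
    hDc.ordConnected.convex.lipschitzOnWith_of_nnnorm_hasDerivWithin_le
      (fun t ht => (hΓd t ht).hasDerivWithinAt) fun t _ => hM _
  have hcl : closure D ⊆ D := by
    -- The curve has a limit `y` at `t`, and the integral curves that start near `y` live long
    -- enough to cross `t`.
    intro t ht
    have : (𝓝[D] t).NeBot := mem_closure_iff_nhdsWithin_neBot.1 ht
    have hca : Cauchy (map Γ (𝓝[D] t)) :=
      cauchy_map_iff'.2 <| hlip.uniformContinuousOn.mono_left <| le_inf
        (cauchy_nhds.mono nhdsWithin_le_nhds).2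
        (le_principal_iff.2 (prod_mem_prod self_mem_nhdsWithin self_mem_nhdsWithin))
    obtain ⟨y, hy⟩ := CompleteSpace.complete hca
    obtain ⟨r, hr, τ, hτ, α, h1, -⟩ := exists_local_flow hV y
    have e1 : ∀ᶠ s in 𝓝[D] t, Γ s ∈ Metric.closedBall y r := hy (Metric.closedBall_mem_nhds y hr)
    have e2 : ∀ᶠ s in 𝓝[D] t, s ∈ Set.Ioo (t - τ) (t + τ) :=
      mem_nhdsWithin_of_mem_nhds (Ioo_mem_nhds (by linarith) (by linarith))
    obtain ⟨s, hs1, hs2, hsD⟩ := (e1.and (e2.and self_mem_nhdsWithin)).exists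
    obtain ⟨h2, h3⟩ := h1 _ hs1
    set β : ℝ → X := fun r => α (Γ s) (r - s) with hβ
    set J := Set.Ioo (s - τ) (s + τ) with hJ
    have hβd : ∀ r ∈ J, HasDerivAt β (V (β r)) r := by
      intro r hr
      exact (h3 (r - s) ⟨by linarith [hr.1], by linarith [hr.2]⟩).comp_sub_const r s
    have hsJ : s ∈ J := ⟨by linarith, by linarith⟩
    have hβs : β s = Γ s := by simp [hβ, h2]
    have heq : Set.EqOn Γ β (D ∩ J) := integralCurve_eqOn hV (hDo.inter isOpen_Ioo)
      ((hDc.ordConnected.inter Set.ordConnected_Ioo).isPreconnected)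
      (fun r hr => hΓd r hr.1) (fun r hr => hβd r hr.2) ⟨hsD, hsJ⟩ hβs.symm
    set δ : ℝ → X := fun r => if r ∈ D then Γ r else β r with hδ
    have hδD : Set.EqOn δ Γ D := fun r hr => by simp [hδ, hr]
    have hδJ : Set.EqOn δ β J := fun r hr => by
      by_cases h : r ∈ D
      · rw [hδD h, heq ⟨h, hr⟩]
      · simp [hδ, h]
    refine ⟨D ∪ J, ⟨δ, hDo.union isOpen_Ioo, hDc.union s hsD hsJ isPreconnected_Ioo, Or.inl h0D,
      (hδD h0D).trans hΓ0, ?_⟩, Or.inr ⟨by linarith [hs2.2], by linarith [hs2.1]⟩⟩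
    rintro r (hr | hr)
    · rw [hδD hr]
      exact (hΓd r hr).congr_of_eventuallyEq (Filter.mem_of_superset (hDo.mem_nhds hr) hδD)
    · rw [hδJ hr]
      exact (hβd r hr).congr_of_eventuallyEq (Filter.mem_of_superset (isOpen_Ioo.mem_nhds hr) hδJ)
  have hD : D = Set.univ :=
    IsClopen.eq_univ ⟨isClosed_of_closure_subset hcl, hDo⟩ ⟨0, h0D⟩
  exact ⟨Γ, hΓ0, fun t => hΓd t (hD ▸ Set.mem_univ t)⟩

/-- `φ` is the flow of `V`: `φ t x` is the position at time `t` of the integral curve starting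
at `x`. -/
structure IsFlowOf (φ : ℝ → X → X) (V : X → X) : Prop where
  zero : ∀ x, φ 0 x = x
  hasDerivAt : ∀ x t, HasDerivAt (fun s => φ s x) (V (φ t x)) t

theorem exists_isFlowOf [CompleteSpace X] (hV : LocallyLipschitz V) {M : ℝ}
    (hM : ∀ x, ‖V x‖ ≤ M) : ∃ φ, IsFlowOf φ V := by
  choose γ h1 h2 using fun x => exists_global_integralCurve hV hM x
  exact ⟨fun t x => γ x t, h1, fun x t => h2 x t⟩

namespace IsFlowOf

variable {φ : ℝ → X → X}

theorem eq_of_integralCurve (hφ : IsFlowOf φ V) (hV : LocallyLipschitz V) {γ : ℝ → X}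
    (hγ : ∀ t, HasDerivAt γ (V (γ t)) t) (t : ℝ) : γ t = φ t (γ 0) :=
  integralCurve_eqOn hV isOpen_univ isPreconnected_univ (fun s _ => hγ s)
    (fun s _ => hφ.hasDerivAt (γ 0) s) (Set.mem_univ 0) (hφ.zero _).symm (Set.mem_univ t)

theorem add (hφ : IsFlowOf φ V) (hV : LocallyLipschitz V) (s t : ℝ) (x : X) :
    φ (s + t) x = φ s (φ t x) := by
  have := hφ.eq_of_integralCurve hV (γ := fun r => φ (r + t) x)
    (fun r => (hφ.hasDerivAt x (r + t)).comp_add_const r t) s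
  simpa using this

theorem dist_le (hφ : IsFlowOf φ V) {M : ℝ} (hM : ∀ x, ‖V x‖ ≤ M) (s t : ℝ) (x : X) :
    ‖φ t x - φ s x‖ ≤ M * ‖t - s‖ :=
  convex_univ.norm_image_sub_le_of_norm_hasDerivWithin_le
    (fun r _ => (hφ.hasDerivAt x r).hasDerivWithinAt) (fun _ _ => hM _) (Set.mem_univ s)
    (Set.mem_univ t)

theorem continuous [CompleteSpace X] (hφ : IsFlowOf φ V) (hV : LocallyLipschitz V) (t : ℝ) :
    Continuous (φ t) := by
  have hloc : ∀ y, ∃ τ > 0, ∀ᶠ z in 𝓝 y, ∀ s ∈ Set.Ioo (-τ) τ, ContinuousAt (φ s) z := by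
    intro y
    obtain ⟨r, hr, τ, hτ, α, h1, h2⟩ := exists_local_flow hV y
    refine ⟨τ, hτ, Filter.mem_of_superset (Metric.ball_mem_nhds y hr) fun z hz s hs => ?_⟩
    refine ((h2 s hs).continuousAt (Metric.closedBall_mem_nhds_of_mem hz)).congr ?_
    filter_upwards [Metric.closedBall_mem_nhds_of_mem hz] with w hw
    exact integralCurve_eqOn hV isOpen_Ioo isPreconnected_Ioo (h1 w hw).2
      (fun s _ => hφ.hasDerivAt w s) (⟨by linarith, hτ⟩ : (0 : ℝ) ∈ Set.Ioo (-τ) τ)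
      ((h1 w hw).1.trans (hφ.zero w).symm) hs
  rw [continuous_iff_continuousAt]
  intro x
  -- Near `φ t x` the flow is continuous for small times, so continuity of `φ t` at `x` is both an
  -- open and a closed condition on `t`.
  have hclopen : ∀ t, ∀ᶠ t' in 𝓝 t, (ContinuousAt (φ t) x ↔ ContinuousAt (φ t') x) := by
    intro t
    obtain ⟨τ, hτ, h⟩ := hloc (φ t x)
    have hc : ContinuousAt (fun s => φ s x) t := (hφ.hasDerivAt x t).continuousAt
    filter_upwards [hc.eventually h, Ioo_mem_nhds (show t - τ < t by linarith)
      (show t < t + τ by linarith)] with t' h1 h2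
    have e1 : φ t = fun z => φ (t - t') (φ t' z) := by
      funext z
      rw [← hφ.add hV, sub_add_cancel]
    have e2 : φ t' = fun z => φ (t' - t) (φ t z) := by
      funext z
      rw [← hφ.add hV, sub_add_cancel]
    constructor
    · intro hh
      rw [e2]
      exact ContinuousAt.comp (f := φ t)
        (h.self_of_nhds _ ⟨by linarith [h2.1], by linarith [h2.2]⟩) hh
    · intro hh
      rw [e1]
      exact ContinuousAt.comp (f := φ t')
        (h1 _ ⟨by linarith [h2.2], by linarith [h2.1]⟩) hh
  have hcl : IsClopen {t | ContinuousAt (φ t) x} := by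
    refine ⟨isOpen_compl_iff.1 (isOpen_iff_mem_nhds.2 fun t ht => ?_),
      isOpen_iff_mem_nhds.2 fun t ht => ?_⟩
    · filter_upwards [hclopen t] with t' h using fun h' => ht (h.2 h')
    · filter_upwards [hclopen t] with t' h using h.1 ht
  have h0 : ContinuousAt (φ 0) x := by
    rw [show φ 0 = id from funext hφ.zero]
    exact continuousAt_id
  have := hcl.eq_univ ⟨0, h0⟩
  exact Set.eq_univ_iff_forall.1 this t

theorem continuous_uncurry [CompleteSpace X] (hφ : IsFlowOf φ V) (hV : LocallyLipschitz V)
    {M : ℝ} (hM : ∀ x, ‖V x‖ ≤ M) : Continuous fun p : ℝ × X => φ p.1 p.2 := by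
  have hM0 : 0 ≤ M := (norm_nonneg _).trans (hM 0)
  refine continuous_prod_of_continuous_lipschitzWith _ (.mk M hM0) ?_ ?_
  rotate_left
  · intro x
    exact LipschitzWith.of_dist_le_mul fun s t => by
      rw [dist_eq_norm, dist_eq_norm]
      exact hφ.dist_le hM t s x
  · exact fun t => hφ.continuous hV t

/-- The time `t` map of a flow. -/
def toHomeomorph [CompleteSpace X] (hφ : IsFlowOf φ V) (hV : LocallyLipschitz V) (t : ℝ) :
    X ≃ₜ X where
  toFun := φ t
  invFun := φ (-t)
  left_inv x := by rw [← hφ.add hV, neg_add_cancel, hφ.zero]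
  right_inv x := by rw [← hφ.add hV, add_neg_cancel, hφ.zero]
  continuous_toFun := hφ.continuous hV t
  continuous_invFun := hφ.continuous hV (-t)

/-- Uniqueness makes a flow commute with the continuous linear symmetries of its vector field. -/
theorem map_comm (hφ : IsFlowOf φ V) (hV : LocallyLipschitz V) (L : X →L[ℝ] X)
    (hL : ∀ x, V (L x) = L (V x)) (t : ℝ) (x : X) : φ t (L x) = L (φ t x) := by
  have := hφ.eq_of_integralCurve hV (γ := fun r => L (φ r x))
    (fun r => by
      rw [hL]
      exact L.hasFDerivAt.comp_hasDerivAt r (hφ.hasDerivAt x r)) t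
  simpa [hφ.zero] using this.symm

end IsFlowOf

end Flows

/-! ### Averages over one-parameter groups of isometries -/

section MeanValue

variable {F : Type*} [NormedAddCommGroup F] [NormedSpace ℝ F]

/-- The mean value of a bounded continuous function on `ℝ`: the limit of its averages over `[0, t]`
along a fixed ultrafilter of times `t → ∞`. -/
def meanValue (u : ℝ → F) : F :=
  limUnder (Ultrafilter.of (atTop : Filter ℝ) : Filter ℝ) fun t => t⁻¹ • ∫ s in (0 : ℝ)..t, u s

theorem norm_average_le {u : ℝ → F} {M : ℝ} (hM : ∀ s, ‖u s‖ ≤ M) {t : ℝ} (ht : 0 < t) :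
    ‖t⁻¹ • ∫ s in (0 : ℝ)..t, u s‖ ≤ M := by
  have h := intervalIntegral.norm_integral_le_of_norm_le_const (a := 0) (b := t)
    fun s _ => hM s
  rw [sub_zero, abs_of_pos ht] at h
  rw [norm_smul, norm_inv, Real.norm_of_nonneg ht.le, inv_mul_le_iff₀ ht]
  linarith

theorem eventually_ultrafilter_pos :
    ∀ᶠ t in (Ultrafilter.of (atTop : Filter ℝ) : Filter ℝ), 0 < t :=
  Ultrafilter.of_le _ (eventually_gt_atTop 0)

theorem tendsto_meanValue [FiniteDimensional ℝ F] {u : ℝ → F} {M : ℝ} (hM : ∀ s, ‖u s‖ ≤ M) :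
    Tendsto (fun t => t⁻¹ • ∫ s in (0 : ℝ)..t, u s)
      (Ultrafilter.of (atTop : Filter ℝ) : Filter ℝ) (𝓝 (meanValue u)) := by
  have : ProperSpace F := FiniteDimensional.proper ℝ F
  refine tendsto_nhds_limUnder ?_
  have hmem : ((Ultrafilter.of (atTop : Filter ℝ)).map
      fun t => t⁻¹ • ∫ s in (0 : ℝ)..t, u s : Filter F) ≤ 𝓟 (Metric.closedBall 0 M) := by
    rw [le_principal_iff, Ultrafilter.mem_coe, Ultrafilter.mem_map, ← Ultrafilter.mem_coe]
    filter_upwards [eventually_ultrafilter_pos] with t ht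
    simpa using norm_average_le hM ht
  obtain ⟨x, -, hx⟩ := (isCompact_closedBall (0 : F) M).ultrafilter_le_nhds _ hmem
  exact ⟨x, hx⟩

variable [FiniteDimensional ℝ F]

theorem norm_meanValue_sub_le {u v : ℝ → F} (hu : Continuous u) (hv : Continuous v) {M N η : ℝ}
    (hM : ∀ s, ‖u s‖ ≤ M) (hN : ∀ s, ‖v s‖ ≤ N) (h : ∀ s, ‖u s - v s‖ ≤ η) :
    ‖meanValue u - meanValue v‖ ≤ η := by
  refine le_of_tendsto ((tendsto_meanValue hM).sub (tendsto_meanValue hN)).norm ?_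
  filter_upwards [eventually_ultrafilter_pos] with t ht
  rw [← smul_sub, ← intervalIntegral.integral_sub (hu.intervalIntegrable _ _)
    (hv.intervalIntegrable _ _)]
  exact norm_average_le h ht

theorem meanValue_const (w : F) : meanValue (fun _ => w) = w := by
  refine tendsto_nhds_unique (tendsto_meanValue fun _ => le_refl ‖w‖) (tendsto_const_nhds.congr' ?_)
  filter_upwards [eventually_ultrafilter_pos] with t ht
  rw [intervalIntegral.integral_const, sub_zero, smul_smul, inv_mul_cancel₀ ht.ne', one_smul]

theorem meanValue_comp_clm {u : ℝ → F} (hu : Continuous u) {M : ℝ} (hM : ∀ s, ‖u s‖ ≤ M)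
    (L : F →L[ℝ] F) : meanValue (fun s => L (u s)) = L (meanValue u) := by
  refine tendsto_nhds_unique (tendsto_meanValue (M := ‖L‖ * M) fun s => ?_) ?_
  · exact (L.le_opNorm _).trans (by gcongr; exact hM s)
  · refine ((L.continuous.tendsto _).comp (tendsto_meanValue hM)).congr fun t => ?_
    simp only [Function.comp_apply, map_smul]
    rw [L.intervalIntegral_comp_comm (hu.intervalIntegrable _ _)]

/-- The mean value is invariant under translations of time. -/
theorem meanValue_comp_add {u : ℝ → F} (hu : Continuous u) {M : ℝ} (hM : ∀ s, ‖u s‖ ≤ M)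
    (r : ℝ) : meanValue (fun s => u (s + r)) = meanValue u := by
  have h1 := (tendsto_meanValue fun s => hM (s + r)).sub (tendsto_meanValue hM)
  have h2 : Tendsto (fun t : ℝ => t⁻¹ • ∫ s in (0 : ℝ)..t, u (s + r))
      (Ultrafilter.of (atTop : Filter ℝ) : Filter ℝ) (𝓝 (meanValue fun s => u (s + r))) :=
    tendsto_meanValue fun s => hM (s + r)
  rw [← sub_eq_zero]
  refine tendsto_nhds_unique h1 (squeeze_zero_norm' (a := fun t : ℝ => t⁻¹ * (2 * M * |r|)) ?_ ?_)
  · filter_upwards [eventually_ultrafilter_pos] with t ht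
    have e : (∫ s in (0 : ℝ)..t, u (s + r)) - ∫ s in (0 : ℝ)..t, u s
        = (∫ s in t..t + r, u s) - ∫ s in (0 : ℝ)..r, u s := by
      rw [intervalIntegral.integral_comp_add_right, zero_add,
        intervalIntegral.integral_interval_sub_interval_comm' (hu.intervalIntegrable _ _)
          (hu.intervalIntegrable _ _) (hu.intervalIntegrable _ _)]
    rw [← smul_sub, e, norm_smul, norm_inv, Real.norm_of_nonneg ht.le]
    gcongr
    have a1 := intervalIntegral.norm_integral_le_of_norm_le_const (a := t) (b := t + r)
      fun s _ => hM s
    have a2 := intervalIntegral.norm_integral_le_of_norm_le_const (a := 0) (b := r)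
      fun s _ => hM s
    rw [add_sub_cancel_left] at a1
    rw [sub_zero] at a2
    refine (norm_sub_le _ _).trans ?_
    linarith
  · have := (tendsto_inv_atTop_zero (𝕜 := ℝ)).mul_const (2 * M * |r|)
    rw [zero_mul] at this
    exact this.mono_left (Ultrafilter.of_le _)

end MeanValue

/-- A strongly continuous one-parameter group of linear isometries of a normed space. -/
structure IsometryRep (X : Type*) [NormedAddCommGroup X] [NormedSpace ℝ X] where
  /-- The isometry at time `s`. -/
  map : ℝ → X →ₗᵢ[ℝ] X
  map_zero : ∀ x, map 0 x = x
  map_add : ∀ s t x, map (s + t) x = map s (map t x)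
  continuous_orbit : ∀ x, Continuous fun s => map s x

instance (X : Type*) [NormedAddCommGroup X] [NormedSpace ℝ X] :
    CoeFun (IsometryRep X) fun _ => ℝ → X →ₗᵢ[ℝ] X := ⟨IsometryRep.map⟩

namespace IsometryRep

variable {X : Type*} [NormedAddCommGroup X] [NormedSpace ℝ X] (σ : IsometryRep X)

theorem neg_apply_apply (s : ℝ) (x : X) : σ (-s) (σ s x) = x := by
  rw [← σ.map_add, neg_add_cancel, σ.map_zero]

theorem apply_neg_apply (s : ℝ) (x : X) : σ s (σ (-s) x) = x := by
  rw [← σ.map_add, add_neg_cancel, σ.map_zero]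

theorem continuous_uncurry : Continuous fun p : ℝ × X => σ p.1 p.2 :=
  continuous_prod_of_continuous_lipschitzWith' _ 1 (fun s => (σ s).lipschitz) σ.continuous_orbit

end IsometryRep

section LipschitzApproximation

/-- A bounded, uniformly continuous real function on a subset of a metric space is uniformly
approximated by the restrictions of Lipschitz functions on the whole space: the functions
`x ↦ inf_a (f a + L d(x, a))` with `L` large. -/
theorem exists_lipschitz_approx_real {X : Type*} [PseudoMetricSpace X] {O : Set X} {f : X → ℝ}
    {M : ℝ} (hM : ∀ x ∈ O, |f x| ≤ M) (hf : UniformContinuousOn f O) {η : ℝ} (hη : 0 < η) :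
    ∃ (g : X → ℝ) (K : NNReal), LipschitzWith K g ∧ ∀ x ∈ O, |g x - f x| ≤ η := by
  rcases O.eq_empty_or_nonempty with rfl | ⟨p, hp⟩
  · exact ⟨fun _ => 0, 0, LipschitzWith.const 0, by simp⟩
  have hM0 : 0 ≤ M := (abs_nonneg _).trans (hM p hp)
  obtain ⟨δ, hδ, hfδ⟩ := Metric.uniformContinuousOn_iff.1 hf η hη
  have : Nonempty O := ⟨⟨p, hp⟩⟩
  -- With this slope, points `a` at distance `≥ δ` do not matter for the infimum.
  set L : ℝ := 2 * M / δ with hL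
  have hL0 : 0 ≤ L := by positivity
  have hbdd : ∀ x : X, BddBelow (Set.range fun a : O => f a + L * dist x a) := by
    intro x
    refine ⟨-M, ?_⟩
    rintro _ ⟨a, rfl⟩
    have := (abs_le.1 (hM a a.2)).1
    have h2 : 0 ≤ L * dist x a := by positivity
    simp only
    linarith
  refine ⟨fun x => ⨅ a : O, (f a + L * dist x a), .mk L hL0, ?_, ?_⟩
  · refine LipschitzWith.of_le_add_mul _ fun x y => ?_
    rw [ciInf_add (hbdd _)]
    refine le_ciInf fun a => (ciInf_le (hbdd _) a).trans ?_
    have h1 : L * dist x a ≤ L * (dist x y + dist y a) := by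
      gcongr
      exact dist_triangle _ _ _
    simp only [NNReal.coe_mk]
    change _ ≤ _ + L * _
    linarith
  · intro x hx
    have h1 : (⨅ a : O, (f a + L * dist x a)) ≤ f x := by
      have := ciInf_le (hbdd x) ⟨x, hx⟩
      simpa using this
    have h2 : f x - η ≤ ⨅ a : O, (f a + L * dist x a) := by
      refine le_ciInf fun a => ?_
      rcases lt_or_ge (dist x a) δ with h | h
      · have h3 := hfδ x hx a a.2 h
        rw [Real.dist_eq] at h3
        have h4 := (abs_lt.1 h3).2
        have h5 : 0 ≤ L * dist x a := by positivity
        linarith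
      · have h3 : L * δ ≤ L * dist x a := by gcongr
        rw [hL, div_mul_cancel₀ _ hδ.ne'] at h3
        have h4 := (abs_le.1 (hM a a.2)).1
        have h5 := (abs_le.1 (hM x hx)).2
        linarith
    rw [abs_le]
    constructor <;> linarith

theorem exists_lipschitz_approx {X : Type*} [PseudoMetricSpace X] {F : Type*}
    [NormedAddCommGroup F] [NormedSpace ℝ F] [FiniteDimensional ℝ F] {O : Set X} {f : X → F}
    {M : ℝ} (hM : ∀ x ∈ O, ‖f x‖ ≤ M) (hf : UniformContinuousOn f O) {η : ℝ} (hη : 0 < η) :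
    ∃ (g : X → F) (K : NNReal), LipschitzWith K g ∧ ∀ x ∈ O, ‖g x - f x‖ ≤ η := by
  let e : F ≃L[ℝ] (Fin (Module.finrank ℝ F) → ℝ) := (Module.finBasis ℝ F).equivFunL
  set S : F →L[ℝ] (Fin (Module.finrank ℝ F) → ℝ) := e.toContinuousLinearMap with hS
  set R : (Fin (Module.finrank ℝ F) → ℝ) →L[ℝ] F := e.symm.toContinuousLinearMap with hR
  set η' : ℝ := η / (‖R‖ + 1) with hη'
  have hη'0 : 0 < η' := by positivity
  have hcoord : ∀ i, ∃ (g : X → ℝ) (K : NNReal), LipschitzWith K g ∧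
      ∀ x ∈ O, |g x - S (f x) i| ≤ η' := by
    intro i
    refine exists_lipschitz_approx_real (M := ‖S‖ * M) (fun x hx => ?_) ?_ hη'0
    · calc |S (f x) i| ≤ ‖S (f x)‖ := norm_le_pi_norm (S (f x)) i
        _ ≤ ‖S‖ * ‖f x‖ := S.le_opNorm _
        _ ≤ ‖S‖ * M := by gcongr; exact hM x hx
    · have h1 : UniformContinuous fun v : F => S v i :=
        ((ContinuousLinearMap.proj (R := ℝ) i).comp S).uniformContinuous
      exact h1.comp_uniformContinuousOn hf
  choose g K hg hgf using hcoord
  have hgl : LipschitzWith (Finset.univ.sup K) fun x i => g i x :=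
    LipschitzWith.of_dist_le_mul fun x y => by
      rw [dist_pi_le_iff (by positivity)]
      intro i
      refine ((hg i).dist_le_mul x y).trans ?_
      gcongr
      exact Finset.le_sup (Finset.mem_univ i)
  refine ⟨fun x => R fun i => g i x, _, R.lipschitz.comp hgl, fun x hx => ?_⟩
  have h1 : f x = R (S (f x)) := (e.symm_apply_apply (f x)).symm
  rw [h1, ← map_sub]
  calc ‖R ((fun i => g i x) - S (f x))‖ ≤ ‖R‖ * ‖(fun i => g i x) - S (f x)‖ := R.le_opNorm _
    _ ≤ ‖R‖ * η' := by
      gcongr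
      rw [pi_norm_le_iff_of_nonneg hη'0.le]
      exact fun i => hgf i x hx
    _ ≤ η := by
      rw [hη', mul_div_assoc', div_le_iff₀ (by positivity)]
      nlinarith [norm_nonneg R]

variable {X : Type*} [NormedAddCommGroup X] [NormedSpace ℝ X] (σ : IsometryRep X)
  {F : Type*} [NormedAddCommGroup F] [NormedSpace ℝ F] [FiniteDimensional ℝ F]
  (ρ : IsometryRep F)

/-- An equivariant map on an invariant set that is bounded, uniformly continuous and finite
dimensional valued is approximated by globally defined equivariant Lipschitz maps: average a
Lipschitz approximation over the group. -/
theorem exists_equivariant_lipschitz_approx {O : Set X} (hO : ∀ s, ∀ x ∈ O, σ s x ∈ O)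
    {f : X → F} (hfe : ∀ s, ∀ x ∈ O, f (σ s x) = ρ s (f x)) {M : ℝ} (hM : ∀ x ∈ O, ‖f x‖ ≤ M)
    (hf : UniformContinuousOn f O) {η : ℝ} (hη : 0 < η) :
    ∃ (g : X → F) (K : NNReal), LipschitzWith K g ∧ (∀ s x, g (σ s x) = ρ s (g x)) ∧
      ∀ x ∈ O, ‖g x - f x‖ ≤ η := by
  obtain ⟨g, K, hg, hgf⟩ := exists_lipschitz_approx hM hf hη
  have hcont : ∀ x, Continuous fun s => ρ (-s) (g (σ s x)) := fun x =>
    ρ.continuous_uncurry.comp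
      (continuous_neg.prodMk (hg.continuous.comp (σ.continuous_orbit x)))
  have hbd : ∀ x s, ‖ρ (-s) (g (σ s x))‖ ≤ K * ‖x‖ + ‖g 0‖ := by
    intro x s
    rw [LinearIsometry.norm_map]
    have h1 := hg.dist_le_mul (σ s x) 0
    rw [dist_eq_norm, dist_zero_right, LinearIsometry.norm_map] at h1
    have h2 := norm_le_norm_sub_add (g (σ s x)) (g 0)
    linarith
  refine ⟨fun x => meanValue fun s => ρ (-s) (g (σ s x)), K, ?_, fun r x => ?_, fun x hx => ?_⟩
  · refine LipschitzWith.of_dist_le_mul fun x y => ?_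
    rw [dist_eq_norm]
    refine norm_meanValue_sub_le (hcont x) (hcont y) (hbd x) (hbd y) fun s => ?_
    rw [← _root_.map_sub, LinearIsometry.norm_map, ← dist_eq_norm]
    simpa using hg.dist_le_mul (σ s x) (σ s y)
  · have e : (fun s => ρ (-s) (g (σ s (σ r x))))
        = fun s => (ρ r).toContinuousLinearMap (ρ (-(s + r)) (g (σ (s + r) x))) := by
      funext s
      rw [LinearIsometry.coe_toContinuousLinearMap, ← ρ.map_add, ← σ.map_add]
      congr 2
      ring
    change meanValue (fun s => ρ (-s) (g (σ s (σ r x)))) = _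
    rw [e, meanValue_comp_clm (u := fun s => ρ (-(s + r)) (g (σ (s + r) x)))
      ((hcont x).comp (continuous_add_const r)) (fun s => hbd x (s + r)),
      meanValue_comp_add (u := fun s => ρ (-s) (g (σ s x))) (hcont x) (hbd x)]
    rfl
  · rw [← meanValue_const (f x)]
    refine norm_meanValue_sub_le (hcont x) continuous_const (hbd x) (fun _ => le_rfl) fun s => ?_
    have h1 : f x = ρ (-s) (f (σ s x)) := by rw [hfe s x hx, ρ.neg_apply_apply]
    rw [h1, ← _root_.map_sub, LinearIsometry.norm_map]
    exact hgf _ (hO s x hx)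

end LipschitzApproximation

/-! ### Equivariant partitions of unity and selections -/

section Bump

variable {Y : Type*} [PseudoMetricSpace Y]

/-- The function measuring the distance to the complement of `v`, or `1` if `v` is everything. -/
def bump (v : Set Y) (x : Y) : ℝ :=
  open Classical in if vᶜ = ∅ then 1 else Metric.infDist x vᶜ

theorem lipschitz_bump (v : Set Y) : LipschitzWith 1 (bump v) := by
  unfold bump
  split_ifs
  · exact (LipschitzWith.const 1).weaken zero_le_one
  · exact Metric.lipschitz_infDist_pt _

theorem bump_nonneg (v : Set Y) (x : Y) : 0 ≤ bump v x := by
  unfold bump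
  split_ifs
  exacts [zero_le_one, Metric.infDist_nonneg]

theorem bump_pos_iff {v : Set Y} (hv : IsOpen v) (x : Y) : 0 < bump v x ↔ x ∈ v := by
  unfold bump
  split_ifs with h
  · simp [Set.compl_empty_iff.1 h]
  · rw [← hv.isClosed_compl.notMem_iff_infDist_pos (Set.nonempty_iff_ne_empty.2 h),
      Set.notMem_compl_iff]

theorem _root_.LocallyLipschitz.finset_sum {G ι : Type*} [NormedAddCommGroup G] (J : Finset ι)
    {f : ι → Y → G} (hf : ∀ i ∈ J, LocallyLipschitz (f i)) :
    LocallyLipschitz fun z => ∑ i ∈ J, f i z := by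
  classical
  induction J using Finset.induction_on with
  | empty => simpa using LocallyLipschitz.const (0 : G)
  | insert a J ha ih =>
    simp_rw [Finset.sum_insert ha]
    exact (hf a (Finset.mem_insert_self a J)).add
      (ih fun i hi => hf i (Finset.mem_insert_of_mem hi))

end Bump

namespace IsometryRep

variable {X : Type*} [NormedAddCommGroup X] [NormedSpace ℝ X]

variable (σ : IsometryRep X)

theorem edist_map_map (s : ℝ) (x y : X) : edist (σ s x) (σ s y) = edist x y :=
  (σ s).isometry.edist_eq x y

/-- The distance between the orbits of two points. -/
def orbitEDist (x y : X) : ENNReal := ⨅ s : ℝ, edist x (σ s y)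

theorem orbitEDist_le (x y : X) : σ.orbitEDist x y ≤ edist x y :=
  (iInf_le _ 0).trans (by rw [σ.map_zero])

theorem orbitEDist_comm (x y : X) : σ.orbitEDist x y = σ.orbitEDist y x := by
  have h : ∀ x y : X, σ.orbitEDist x y ≤ σ.orbitEDist y x := by
    intro x y
    refine le_iInf fun s => (iInf_le _ (-s)).trans ?_
    rw [← σ.edist_map_map s, σ.apply_neg_apply, edist_comm]
  exact le_antisymm (h x y) (h y x)

theorem orbitEDist_triangle (x y z : X) :
    σ.orbitEDist x z ≤ σ.orbitEDist x y + σ.orbitEDist y z := by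
  unfold orbitEDist
  rw [ENNReal.iInf_add]
  refine le_iInf fun s => ?_
  rw [ENNReal.add_iInf]
  refine le_iInf fun t => (iInf_le _ (s + t)).trans ?_
  rw [σ.map_add]
  refine (edist_triangle x (σ s y) _).trans ?_
  rw [σ.edist_map_map]

/-- The space `X` with the pseudodistance between orbits of `σ`. Its open sets are the invariant
open subsets of `X`. -/
def OrbitSpace (_σ : IsometryRep X) : Type _ := X

instance : PseudoEMetricSpace σ.OrbitSpace where
  edist := σ.orbitEDist
  edist_self x := le_antisymm ((σ.orbitEDist_le x x).trans (edist_self (α := X) x).le) bot_le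
  edist_comm := σ.orbitEDist_comm
  edist_triangle := σ.orbitEDist_triangle

/-- Invariance of a subset under the group. -/
def Invariant (U : Set X) : Prop := ∀ s, ∀ x ∈ U, σ s x ∈ U

variable {σ}

theorem Invariant.mem_iff {U : Set X} (hU : σ.Invariant U) (s : ℝ) (x : X) :
    σ s x ∈ U ↔ x ∈ U :=
  ⟨fun h => by simpa [σ.neg_apply_apply] using hU (-s) _ h, hU s x⟩

theorem Invariant.compl {U : Set X} (hU : σ.Invariant U) : σ.Invariant Uᶜ :=
  fun s x hx h => hx ((hU.mem_iff s x).1 h)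

theorem isOpen_orbitSpace {U : Set X} :
    IsOpen (X := σ.OrbitSpace) U ↔ IsOpen U ∧ σ.Invariant U := by
  have e1 : IsOpen (X := σ.OrbitSpace) U ↔
      ∀ x ∈ U, ∃ ε > 0, ∀ y : X, σ.orbitEDist y x < ε → y ∈ U := EMetric.isOpen_iff
  have e2 : IsOpen U ↔ ∀ x ∈ U, ∃ ε > 0, ∀ y : X, edist y x < ε → y ∈ U := EMetric.isOpen_iff
  rw [e1, e2]
  constructor
  · intro h
    refine ⟨fun x hx => ?_, fun s x hx => ?_⟩
    · obtain ⟨ε, hε, h'⟩ := h x hx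
      exact ⟨ε, hε, fun y hy => h' y ((σ.orbitEDist_le y x).trans_lt hy)⟩
    · obtain ⟨ε, hε, h'⟩ := h x hx
      refine h' _ (lt_of_le_of_lt (iInf_le _ s) ?_)
      rwa [edist_self]
  · rintro ⟨ho, hi⟩ x hx
    obtain ⟨ε, hε, h'⟩ := ho x hx
    refine ⟨ε, hε, fun y hy => ?_⟩
    obtain ⟨s, hs⟩ := iInf_lt_iff.1 hy
    rw [← σ.edist_map_map (-s), σ.neg_apply_apply] at hs
    exact (hi.mem_iff (-s) y).1 (h' _ hs)

theorem continuous_orbitSpace : @Continuous X σ.OrbitSpace _ _ (fun x => x) :=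
  continuous_def.2 fun _ h => ((isOpen_orbitSpace (σ := σ)).1 h).1

/-- Invariant open covers have locally finite refinements by invariant open sets, because the
orbit space is pseudometrizable and therefore paracompact. -/
theorem exists_locallyFinite_refinement {ι : Type*} {U : ι → Set X} (ho : ∀ i, IsOpen (U i))
    (hi : ∀ i, σ.Invariant (U i)) (hc : ∀ x, ∃ i, x ∈ U i) :
    ∃ v : ι → Set X, (∀ i, IsOpen (v i)) ∧ (∀ i, σ.Invariant (v i)) ∧ (∀ x, ∃ i, x ∈ v i) ∧
      LocallyFinite v ∧ ∀ i, v i ⊆ U i := by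
  obtain ⟨v, h1, h2, h3, h4⟩ := precise_refinement (X := σ.OrbitSpace) U
    (fun i => (isOpen_orbitSpace (σ := σ)).2 ⟨ho i, hi i⟩) (Set.iUnion_eq_univ_iff.2 hc)
  exact ⟨v, fun i => ((isOpen_orbitSpace (σ := σ)).1 (h1 i)).1,
    fun i => ((isOpen_orbitSpace (σ := σ)).1 (h1 i)).2,
    Set.iUnion_eq_univ_iff.1 h2, h3.preimage_continuous (continuous_orbitSpace (σ := σ)), h4⟩

/-- The smallest invariant set containing `U`. -/
def saturation (σ : IsometryRep X) (U : Set X) : Set X := {y | ∃ s, σ s y ∈ U}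

theorem subset_saturation (U : Set X) : U ⊆ σ.saturation U := fun x hx => ⟨0, by rwa [σ.map_zero]⟩

theorem invariant_saturation (U : Set X) : σ.Invariant (σ.saturation U) := by
  rintro s x ⟨t, ht⟩
  exact ⟨t + -s, by rwa [σ.map_add, σ.neg_apply_apply]⟩

theorem isOpen_saturation {U : Set X} (hU : IsOpen U) : IsOpen (σ.saturation U) := by
  have : σ.saturation U = ⋃ s, (σ s) ⁻¹' U := by
    ext
    simp [saturation]
  rw [this]
  exact isOpen_iUnion fun s => hU.preimage (σ s).continuous

/-- A finite dimensional invariant subspace. -/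
def IsFinInvariant (σ : IsometryRep X) (Z : Submodule ℝ X) : Prop :=
  FiniteDimensional ℝ Z ∧ σ.Invariant (Z : Set X)

theorem IsFinInvariant.sup {Z W : Submodule ℝ X} (hZ : σ.IsFinInvariant Z)
    (hW : σ.IsFinInvariant W) : σ.IsFinInvariant (Z ⊔ W) := by
  have := hZ.1
  have := hW.1
  refine ⟨inferInstance, fun s x hx => ?_⟩
  obtain ⟨z, hz, w, hw, rfl⟩ := Submodule.mem_sup.1 hx
  rw [_root_.map_add]
  exact Submodule.add_mem_sup (hZ.2 s z hz) (hW.2 s w hw)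

theorem isFinInvariant_bot : σ.IsFinInvariant ⊥ := by
  refine ⟨inferInstance, fun s x hx => ?_⟩
  have hx0 : x = 0 := hx
  rw [hx0, _root_.map_zero]
  exact Submodule.zero_mem ⊥

theorem IsFinInvariant.finset_sup {ι : Type*} (I : Finset ι) {Z : ι → Submodule ℝ X}
    (hZ : ∀ i ∈ I, σ.IsFinInvariant (Z i)) : σ.IsFinInvariant (I.sup Z) :=
  Finset.sup_induction isFinInvariant_bot (fun _ h _ h' => h.sup h') hZ

theorem Invariant.bump_map {v : Set X} (hv : σ.Invariant v) (s : ℝ) (x : X) :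
    bump v (σ s x) = bump v x := by
  unfold bump
  split_ifs
  · rfl
  · have : vᶜ = σ s '' vᶜ := by
      ext y
      constructor
      · exact fun hy => ⟨σ (-s) y, hv.compl _ _ hy, σ.apply_neg_apply s y⟩
      · rintro ⟨z, hz, rfl⟩
        exact hv.compl _ _ hz
    conv_lhs => rw [this]
    exact Metric.infDist_image (σ s).isometry

/-- An equivariant, locally Lipschitz selection of a convex valued map exists as soon as near each
orbit there is a Lipschitz equivariant one with values in a finite dimensional invariant subspace.
The selection is obtained by gluing with an invariant partition of unity, and it locally takes its
values in finite dimensional invariant subspaces. -/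
theorem exists_equivariant_selection {C : X → Set X} (hC : ∀ y, Convex ℝ (C y)) {U : X → Set X}
    {g : X → X → X} (hxU : ∀ x, x ∈ U x) (hUo : ∀ x, IsOpen (U x))
    (hUi : ∀ x, σ.Invariant (U x)) (hgL : ∀ x, ∃ K, LipschitzWith K (g x))
    (hge : ∀ x s y, g x (σ s y) = σ s (g x y))
    (hgZ : ∀ x, ∃ Z, σ.IsFinInvariant Z ∧ ∀ y, g x y ∈ Z)
    (hgC : ∀ x, ∀ y ∈ U x, g x y ∈ C y) :
    ∃ V : X → X, LocallyLipschitz V ∧ (∀ s y, V (σ s y) = σ s (V y)) ∧ (∀ y, V y ∈ C y) ∧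
      ∀ y, ∃ Z, σ.IsFinInvariant Z ∧ ∀ᶠ z in 𝓝 y, V z ∈ Z := by
  classical
  obtain ⟨v, hvo, hvi, hvc, hvf, hvU⟩ :=
    exists_locallyFinite_refinement hUo hUi fun x => ⟨x, hxU x⟩
  choose Z hZ hgZ using hgZ
  set S : X → ℝ := fun y => ∑ᶠ i, bump (v i) y with hS
  set V : X → X := fun y => (S y)⁻¹ • ∑ᶠ i, bump (v i) y • g i y with hV
  have hloc : ∀ y, ∃ I : Finset X, ∀ᶠ z in 𝓝 y, (∀ i, z ∈ v i → i ∈ I) ∧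
      S z = ∑ i ∈ I, bump (v i) z ∧
      V z = (∑ i ∈ I, bump (v i) z)⁻¹ • ∑ i ∈ I, bump (v i) z • g i z := by
    intro y
    obtain ⟨t, ht, hfin⟩ := hvf y
    refine ⟨hfin.toFinset, Filter.mem_of_superset ht fun z hz => ?_⟩
    have h0 : ∀ i, z ∈ v i → i ∈ hfin.toFinset := fun i hi =>
      hfin.mem_toFinset.2 ⟨z, hi, hz⟩
    have h1 : ∀ i, bump (v i) z ≠ 0 → i ∈ hfin.toFinset := fun i hi =>
      h0 i ((bump_pos_iff (hvo i) z).1 ((bump_nonneg _ _).lt_of_ne' hi))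
    have e1 : S z = ∑ i ∈ hfin.toFinset, bump (v i) z :=
      finsum_eq_sum_of_support_subset _ fun i hi => h1 i hi
    refine ⟨h0, e1, ?_⟩
    rw [← e1]
    change _ • _ = _
    congr 1
    refine finsum_eq_sum_of_support_subset _ fun i hi => h1 i fun h => hi ?_
    simp only [h, zero_smul]
  have hpos : ∀ y, ∀ I : Finset X, (∀ i, y ∈ v i → i ∈ I) → 0 < ∑ i ∈ I, bump (v i) y := by
    intro y I hI
    obtain ⟨i, hi⟩ := hvc y
    exact Finset.sum_pos' (fun i _ => bump_nonneg _ _) ⟨i, hI i hi, (bump_pos_iff (hvo i) y).2 hi⟩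
  refine ⟨V, fun y => ?_, fun s y => ?_, fun y => ?_, fun y => ?_⟩
  · obtain ⟨I, hI⟩ := hloc y
    have hsm : LocallyLipschitz fun p : ℝ × X => p.1 • p.2 :=
      (contDiff_fst.smul contDiff_snd : ContDiff ℝ 1 fun p : ℝ × X => p.1 • p.2).locallyLipschitz
    have hnum : LocallyLipschitz fun z => ∑ i ∈ I, bump (v i) z • g i z := by
      refine LocallyLipschitz.finset_sum I fun i _ => ?_
      obtain ⟨K, hK⟩ := hgL i
      exact hsm.comp ((lipschitz_bump (v i)).locallyLipschitz.prodMk hK.locallyLipschitz)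
    have hden : LocallyLipschitz fun z => ∑ i ∈ I, bump (v i) z :=
      LocallyLipschitz.finset_sum I fun i _ => (lipschitz_bump (v i)).locallyLipschitz
    have hd0 := (hpos y I hI.self_of_nhds.1).ne'
    have hq : ContDiffAt ℝ 1 (fun p : ℝ × X => p.1⁻¹ • p.2)
        (∑ i ∈ I, bump (v i) y, ∑ i ∈ I, bump (v i) y • g i y) :=
      (contDiffAt_fst.inv hd0).smul contDiffAt_snd
    obtain ⟨K, t, ht, hK⟩ := hq.exists_lipschitzOnWith
    obtain ⟨K', t', ht', hK'⟩ := (hden.prodMk hnum) y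
    have hpre := (hden.prodMk hnum).continuous.continuousAt.preimage_mem_nhds ht
    obtain ⟨u, hu, hVu⟩ := hI.exists_mem
    refine ⟨K * K', t' ∩ (_ ∩ u), inter_mem ht' (inter_mem hpre hu), ?_⟩
    have h1 := hK.comp (hK'.mono Set.inter_subset_left)
      (fun z hz => hz.2.1 : Set.MapsTo _ (t' ∩ (_ ∩ u)) t)
    intro z hz w hw
    rw [(hVu z hz.2.2).2.2, (hVu w hw.2.2).2.2]
    exact h1 hz hw
  · have e1 : S (σ s y) = S y := finsum_congr fun i => (hvi i).bump_map s y
    have hfs : (Function.support fun i => bump (v i) y • g i y).Finite := by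
      refine (hvf.point_finite y).subset fun i hi => ?_
      refine (bump_pos_iff (hvo i) y).1 ((bump_nonneg _ _).lt_of_ne' fun h => hi ?_)
      simp only [h, zero_smul]
    have e2 : ∑ᶠ i, bump (v i) (σ s y) • g i (σ s y) = σ s (∑ᶠ i, bump (v i) y • g i y) := by
      refine Eq.trans (finsum_congr fun i => ?_)
        ((σ s).toLinearMap.toAddMonoidHom.map_finsum hfs).symm
      rw [(hvi i).bump_map, hge]
      exact ((σ s).map_smul _ _).symm
    change (S (σ s y))⁻¹ • _ = σ s ((S y)⁻¹ • _)
    rw [e1, e2, LinearIsometry.map_smul]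
  · obtain ⟨I, hI⟩ := hloc y
    obtain ⟨h0, -, h2⟩ := hI.self_of_nhds
    rw [h2]
    have := (hC y).centerMass_mem (t := I.filter fun i => y ∈ v i) (w := fun i => bump (v i) y)
      (z := fun i => g i y) (fun i _ => bump_nonneg _ _) ?_
      fun i hi => hgC i y (hvU i (Finset.mem_filter.1 hi).2)
    · rw [Finset.centerMass, Finset.sum_filter_of_ne, Finset.sum_filter_of_ne] at this
      · exact this
      · exact fun i _ hi => (bump_pos_iff (hvo i) y).1
          ((bump_nonneg _ _).lt_of_ne' fun h => hi (by rw [h, zero_smul]))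
      · exact fun i _ hi => (bump_pos_iff (hvo i) y).1 ((bump_nonneg _ _).lt_of_ne' hi)
    · refine hpos y _ fun i hi => Finset.mem_filter.2 ⟨h0 i hi, hi⟩
  · obtain ⟨I, hI⟩ := hloc y
    refine ⟨I.sup Z, IsFinInvariant.finset_sup I fun i _ => hZ i, hI.mono fun z hz => ?_⟩
    rw [hz.2.2]
    refine Submodule.smul_mem _ _ (Submodule.sum_mem _ fun i hi => Submodule.smul_mem _ _ ?_)
    exact Finset.le_sup (f := Z) hi (hgZ i z)

end IsometryRep

/-! ### Pseudogradient fields and deformations -/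

/-- Uniqueness of integral curves on compact intervals. -/
theorem integralCurve_eqOn_Icc {X : Type*} [NormedAddCommGroup X] [NormedSpace ℝ X] {V : X → X}
    (hV : LocallyLipschitz V) {f g : ℝ → X} {a b : ℝ}
    (hf : ∀ s ∈ Set.Icc a b, HasDerivAt f (V (f s)) s)
    (hg : ∀ s ∈ Set.Icc a b, HasDerivAt g (V (g s)) s) (h : f a = g a) :
    Set.EqOn f g (Set.Icc a b) := by
  have hfc : ContinuousOn f (Set.Icc a b) := fun t ht => (hf t ht).continuousAt.continuousWithinAt
  have hgc : ContinuousOn g (Set.Icc a b) := fun t ht => (hg t ht).continuousAt.continuousWithinAt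
  obtain ⟨K, hK⟩ := LocallyLipschitzOn.exists_lipschitzOnWith_of_compact
    ((isCompact_Icc.image_of_continuousOn hfc).union (isCompact_Icc.image_of_continuousOn hgc))
    (hV.locallyLipschitzOn (s := f '' Set.Icc a b ∪ g '' Set.Icc a b))
  exact ODE_solution_unique_of_mem_Icc_right (v := fun _ => V)
    (s := fun _ => f '' Set.Icc a b ∪ g '' Set.Icc a b) (K := K) (fun _ _ => hK) hfc
    (fun t ht => (hf t (Set.Ico_subset_Icc_self ht)).hasDerivWithinAt)
    (fun t ht => Or.inl ⟨t, Set.Ico_subset_Icc_self ht, rfl⟩) hgc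
    (fun t ht => (hg t (Set.Ico_subset_Icc_self ht)).hasDerivWithinAt)
    (fun t ht => Or.inr ⟨t, Set.Ico_subset_Icc_self ht, rfl⟩) h

namespace IsometryRep

variable {X : Type*} [NormedAddCommGroup X] [InnerProductSpace ℝ X] {σ : IsometryRep X}

/-- The restriction of a representation to an invariant subspace. -/
def restrict (σ : IsometryRep X) (Z : Submodule ℝ X) (hZ : σ.Invariant (Z : Set X)) :
    IsometryRep Z where
  map s :=
    { toLinearMap := (σ s).toLinearMap.restrict fun z hz => hZ s z hz
      norm_map' := fun z => (σ s).norm_map z }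
  map_zero z := Subtype.ext (σ.map_zero z)
  map_add s t z := Subtype.ext (σ.map_add s t z)
  continuous_orbit z := (σ.continuous_orbit (z : X)).subtype_mk _

theorem coe_restrict_apply {Z : Submodule ℝ X} (hZ : σ.Invariant (Z : Set X)) (s : ℝ) (z : Z) :
    (σ.restrict Z hZ s z : X) = σ s z := rfl

theorem starProjection_map {Z : Submodule ℝ X} [Z.HasOrthogonalProjection]
    (hZ : σ.Invariant (Z : Set X)) (s : ℝ) (x : X) :
    Z.starProjection (σ s x) = σ s (Z.starProjection x) := by
  refine Submodule.eq_starProjection_of_mem_of_inner_eq_zero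
    (hZ s _ (Z.starProjection_apply_mem x)) fun w hw => ?_
  rw [← σ.apply_neg_apply s w, ← _root_.map_sub, LinearIsometry.inner_map_map]
  exact Submodule.starProjection_inner_eq_zero x _ (hZ (-s) w hw)

theorem orthogonalProjectionOnto_map {Z : Submodule ℝ X} [Z.HasOrthogonalProjection]
    (hZ : σ.Invariant (Z : Set X)) (s : ℝ) (x : X) :
    Z.orthogonalProjectionOnto (σ s x) = σ.restrict Z hZ s (Z.orthogonalProjectionOnto x) :=
  Subtype.ext (starProjection_map hZ s x)

/-- Continuity at one point makes an equivariant map uniformly continuous on the orbit. -/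
theorem uniformContinuousOn_orbit {F : Type*} [NormedAddCommGroup F] [NormedSpace ℝ F]
    {ρ : IsometryRep F} {f : X → F} (hfe : ∀ s x, f (σ s x) = ρ s (f x)) {x : X}
    (hf : ContinuousAt f x) : UniformContinuousOn f (Set.range fun s => σ s x) := by
  rw [Metric.uniformContinuousOn_iff]
  intro ε hε
  obtain ⟨δ, hδ, h⟩ := Metric.continuousAt_iff.1 hf ε hε
  refine ⟨δ, hδ, ?_⟩
  rintro _ ⟨s, rfl⟩ _ ⟨t, rfl⟩ hst
  simp only at hst ⊢
  have e : σ s x = σ t (σ (-t) (σ s x)) := (σ.apply_neg_apply t _).symm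
  rw [e] at hst ⊢
  rw [(σ t).isometry.dist_eq] at hst
  rw [hfe t, hfe t, (ρ t).isometry.dist_eq]
  exact h hst

variable {E : X → ℝ}

theorem fderiv_map (hE : Differentiable ℝ E) (hinv : ∀ s x, E (σ s x) = E x) (s : ℝ) (x v : X) :
    fderiv ℝ E (σ s x) (σ s v) = fderiv ℝ E x v := by
  have h1 : E ∘ σ s = E := funext fun y => hinv s y
  have h2 : HasFDerivAt (E ∘ σ s) ((fderiv ℝ E (σ s x)).comp (σ s).toContinuousLinearMap) x :=
    (hE (σ s x)).hasFDerivAt.comp x (σ s).toContinuousLinearMap.hasFDerivAt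
  rw [h1] at h2
  rw [h2.fderiv]
  rfl

variable [CompleteSpace X]

theorem gradient_map (hE : Differentiable ℝ E) (hinv : ∀ s x, E (σ s x) = E x) (s : ℝ) (x : X) :
    gradient E (σ s x) = σ s (gradient E x) := by
  refine ext_inner_right ℝ fun w => ?_
  rw [← σ.apply_neg_apply s w, LinearIsometry.inner_map_map, gradient, gradient,
    InnerProductSpace.toDual_symm_apply, InnerProductSpace.toDual_symm_apply,
    fderiv_map hE hinv]

/-- The finite dimensional invariant subspaces of a representation have dense union. -/
def HasDenseFinInvariant (σ : IsometryRep X) : Prop :=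
  ∀ x : X, ∀ η > 0, ∃ Z, σ.IsFinInvariant Z ∧ ∃ z ∈ Z, ‖x - z‖ < η

/-- Near the orbit of a regular point there is an equivariant Lipschitz pseudogradient with values
in a finite dimensional invariant subspace: project the gradient on such a subspace, and approximate
it on the orbit. -/
theorem exists_local_pseudogradient (hσ : σ.HasDenseFinInvariant) (hE : ContDiff ℝ 1 E)
    (hinv : ∀ s x, E (σ s x) = E x) {x : X} (hx : fderiv ℝ E x ≠ 0) :
    ∃ g : X → X, (∃ K, LipschitzWith K g) ∧ (∀ s y, g (σ s y) = σ s (g y)) ∧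
      (∃ Z, σ.IsFinInvariant Z ∧ ∀ y, g y ∈ Z) ∧ ‖g x‖ < 1 ∧
      ‖fderiv ℝ E x‖ / 2 < fderiv ℝ E x (g x) := by
  have hEd : Differentiable ℝ E := hE.differentiable one_ne_zero
  set G := gradient E with hG
  have hGn : ‖G x‖ = ‖fderiv ℝ E x‖ := by rw [hG, gradient, LinearIsometryEquiv.norm_map]
  have hGi : ∀ v, inner ℝ (G x) v = fderiv ℝ E x v := fun v =>
    InnerProductSpace.toDual_symm_apply
  set a := ‖G x‖ with ha
  have ha0 : 0 < a := by rw [hGn]; exact norm_pos_iff.2 hx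
  obtain ⟨Z, hZ, z, hz, hxz⟩ := hσ (G x) (a / 10) (by positivity)
  have := hZ.1
  have hGc : Continuous G :=
    (InnerProductSpace.toDual ℝ X).symm.continuous.comp (hE.continuous_fderiv one_ne_zero)
  set ρ := σ.restrict Z hZ.2 with hρ
  -- The projection has norm between `9a/10` and `a`. The factor gives `f x` norm at most `3/4` and
  -- slope at least `243a/400`, so an error of `1/20` leaves norm below `1` and slope above `a/2`.
  set f : X → Z := fun y => (3 / (4 * a)) • Z.orthogonalProjectionOnto (G y) with hf
  have hfe : ∀ s y, f (σ s y) = ρ s (f y) := by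
    intro s y
    simp only [hf]
    rw [hG, gradient_map hEd hinv, orthogonalProjectionOnto_map hZ.2, LinearIsometry.map_smul]
  have hfc : Continuous f :=
    ((3 / (4 * a)) • Z.orthogonalProjectionOnto).continuous.comp hGc
  have hO : ∀ s, ∀ y ∈ Set.range fun r => σ r x, σ s y ∈ Set.range fun r => σ r x := by
    rintro s _ ⟨r, rfl⟩
    exact ⟨s + r, σ.map_add s r x⟩
  have hfb : ∀ y ∈ Set.range fun r => σ r x, ‖f y‖ ≤ ‖f x‖ := by
    rintro _ ⟨r, rfl⟩
    simp only
    rw [hfe, LinearIsometry.norm_map]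
  obtain ⟨g, K, hgL, hge, hgf⟩ := exists_equivariant_lipschitz_approx σ ρ hO
    (fun s y _ => hfe s y) hfb (uniformContinuousOn_orbit hfe hfc.continuousAt)
    (show (0 : ℝ) < 1 / 20 by norm_num)
  have hgx : ‖(g x : X) - f x‖ ≤ 1 / 20 := hgf x ⟨0, σ.map_zero x⟩
  set p := Z.starProjection (G x) with hp
  have hfx : (f x : X) = (3 / (4 * a)) • p := rfl
  have hpn : ‖p‖ ≤ a := Z.norm_starProjection_apply_le (G x)
  have hpa : ‖G x - p‖ ≤ a / 10 := by
    rw [hp, Submodule.starProjection_minimal]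
    exact (ciInf_le ⟨0, by rintro _ ⟨w, rfl⟩; exact norm_nonneg _⟩ (⟨z, hz⟩ : Z)).trans hxz.le
  have hpa' : 9 / 10 * a ≤ ‖p‖ := by
    have := norm_sub_norm_le (G x) p
    linarith
  have hin : inner ℝ (G x) p = ‖p‖ ^ 2 := by
    have := Submodule.starProjection_inner_eq_zero (K := Z) (G x) p (Z.starProjection_apply_mem _)
    rw [inner_sub_left, sub_eq_zero] at this
    rw [this, real_inner_self_eq_norm_sq]
  refine ⟨fun y => g y, ⟨K, fun y w => hgL y w⟩, fun s y => ?_, ⟨Z, hZ, fun y => (g y).2⟩, ?_, ?_⟩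
  · exact congrArg Subtype.val (hge s y)
  · have h1 : ‖(f x : X)‖ ≤ 3 / 4 := by
      rw [hfx, norm_smul, Real.norm_of_nonneg (by positivity)]
      calc 3 / (4 * a) * ‖p‖ ≤ 3 / (4 * a) * a := by gcongr
        _ = 3 / 4 := by field_simp
    have h2 := norm_le_norm_sub_add (g x : X) (f x)
    linarith
  · rw [← hGi, ← hGn]
    have h1 : inner ℝ (G x) (f x : X) = 3 / (4 * a) * ‖p‖ ^ 2 := by
      rw [hfx, real_inner_smul_right, hin]
    have h2 : 3 / (4 * a) * (9 / 10 * a) ^ 2 ≤ 3 / (4 * a) * ‖p‖ ^ 2 := by gcongr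
    have h3 : 3 / (4 * a) * (9 / 10 * a) ^ 2 = 243 / 400 * a := by field_simp; norm_num
    have h4 : |inner ℝ (G x) ((g x : X) - f x)| ≤ a * (1 / 20) :=
      (abs_real_inner_le_norm _ _).trans (by rw [← ha]; gcongr)
    rw [inner_sub_right] at h4
    have h5 := (abs_le.1 h4).1
    linarith

/-- An equivariant pseudogradient field that is locally Lipschitz and locally takes its values in
finite dimensional invariant subspaces. -/
theorem exists_pseudogradient (hσ : σ.HasDenseFinInvariant) (hE : ContDiff ℝ 1 E)
    (hinv : ∀ s x, E (σ s x) = E x) {F : Set X} (hF : IsClosed F) (hFi : σ.Invariant F)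
    (h0F : (0 : X) ∉ F) {b : ℝ} (hb : 0 < b) (hbF : ∀ x ∈ F, b ≤ ‖fderiv ℝ E x‖) :
    ∃ V : X → X, LocallyLipschitz V ∧ (∀ s y, V (σ s y) = σ s (V y)) ∧
      (∀ y, ‖V y‖ ≤ 1 ∧ 0 ≤ fderiv ℝ E y (V y) ∧ (y ∈ F → b / 2 ≤ fderiv ℝ E y (V y)) ∧
        (y = 0 → V y = 0)) ∧
      ∀ y, ∃ Z, σ.IsFinInvariant Z ∧ ∀ᶠ z in 𝓝 y, V z ∈ Z := by
  have hEd : Differentiable ℝ E := hE.differentiable one_ne_zero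
  -- Being zero at the origin is part of the convex constraint, which makes the flow fix the origin.
  let C : X → Set X := fun y => {v | ‖v‖ ≤ 1 ∧ 0 ≤ fderiv ℝ E y v ∧
    (y ∈ F → b / 2 ≤ fderiv ℝ E y v) ∧ (y = 0 → v = 0)}
  have hC : ∀ y, Convex ℝ (C y) := by
    rintro y v ⟨h1, h2, h3, h4⟩ w ⟨k1, k2, k3, k4⟩ α β hα hβ hαβ
    refine ⟨?_, ?_, fun hy => ?_, fun hy => ?_⟩
    · refine (norm_add_le _ _).trans ?_
      rw [norm_smul, norm_smul, Real.norm_of_nonneg hα, Real.norm_of_nonneg hβ]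
      nlinarith
    · rw [_root_.map_add, map_smul, map_smul, smul_eq_mul, smul_eq_mul]
      positivity
    · rw [_root_.map_add, map_smul, map_smul, smul_eq_mul, smul_eq_mul]
      have := h3 hy
      have := k3 hy
      nlinarith
    · rw [h4 hy, k4 hy]
      simp
  have hloc : ∀ x, ∃ (U : Set X) (g : X → X), x ∈ U ∧ IsOpen U ∧ σ.Invariant U ∧
      (∃ K, LipschitzWith K g) ∧ (∀ s y, g (σ s y) = σ s (g y)) ∧
      (∃ Z, σ.IsFinInvariant Z ∧ ∀ y, g y ∈ Z) ∧ ∀ y ∈ U, g y ∈ C y := by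
    intro x
    by_cases hx : x ∈ F
    · have hx0 : fderiv ℝ E x ≠ 0 := by
        rw [← norm_pos_iff]
        exact hb.trans_le (hbF x hx)
      obtain ⟨g, ⟨K, hgL⟩, hge, hgZ, hg1, hg2⟩ := exists_local_pseudogradient hσ hE hinv hx0
      set W : Set X := {y | ‖g y‖ < 1 ∧ b / 2 < fderiv ℝ E y (g y) ∧ y ≠ 0} with hW
      have hWo : IsOpen W := by
        have hc : Continuous fun y => fderiv ℝ E y (g y) :=
          (hE.continuous_fderiv one_ne_zero).clm_apply hgL.continuous
        exact (isOpen_lt hgL.continuous.norm continuous_const).inter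
          ((isOpen_lt continuous_const hc).inter isOpen_ne)
      refine ⟨σ.saturation W, g, subset_saturation W ⟨hg1, ?_, ?_⟩, isOpen_saturation hWo,
        invariant_saturation W, ⟨K, hgL⟩, hge, hgZ, ?_⟩
      · have := hbF x hx
        linarith
      · rintro rfl
        exact h0F hx
      · rintro y ⟨s, h1, h2, h3⟩
        rw [hge, LinearIsometry.norm_map] at h1
        rw [hge, fderiv_map hEd hinv] at h2
        refine ⟨h1.le, by linarith, fun _ => h2.le, fun hy => ?_⟩
        exact absurd (by rw [hy, LinearIsometry.map_zero]) h3
    · refine ⟨Fᶜ, fun _ => 0, hx, hF.isOpen_compl, hFi.compl, ⟨0, LipschitzWith.const 0⟩,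
        fun s y => (LinearIsometry.map_zero _).symm,
        ⟨⊥, isFinInvariant_bot, fun y => Submodule.zero_mem _⟩, fun y hy => ?_⟩
      refine ⟨by simp, by simp, fun h => absurd h hy, fun _ => rfl⟩
  choose U g hxU hUo hUi hgL hge hgZ hgC using hloc
  exact exists_equivariant_selection hC hxU hUo hUi hgL hge hgZ hgC

/-- The descending flow of the pseudogradient, followed for a time `τ`. It lowers `E` by `b τ / 2`
at every point `x` such that the level strip of that height below `x` lies, within distance `τ`
of `x`, in the set `F`. On compact subsets of finite dimensional invariant subspaces it coincides
with equivariant homeomorphisms of finite dimensional invariant subspaces. -/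
theorem exists_deformation (hσ : σ.HasDenseFinInvariant) (hE : ContDiff ℝ 1 E)
    (hinv : ∀ s x, E (σ s x) = E x) {F : Set X} (hF : IsClosed F) (hFi : σ.Invariant F)
    (h0F : (0 : X) ∉ F) {b : ℝ} (hb : 0 < b) (hbF : ∀ x ∈ F, b ≤ ‖fderiv ℝ E x‖) {τ : ℝ}
    (hτ : 0 ≤ τ) :
    ∃ h : X ≃ₜ X, (∀ s x, h (σ s x) = σ s (h x)) ∧ h 0 = 0 ∧ (∀ x, E (h x) ≤ E x) ∧
      (∀ x, (∀ y, ‖y - x‖ ≤ τ → E x - b * τ / 2 ≤ E y → E y ≤ E x → y ∈ F) →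
        E (h x) ≤ E x - b * τ / 2) ∧
      ∀ (Y : Submodule ℝ X) (Γ : Set X), σ.IsFinInvariant Y → IsCompact Γ → Γ ⊆ Y →
        ∃ Z, σ.IsFinInvariant Z ∧ Y ≤ Z ∧ ∀ Z', σ.IsFinInvariant Z' → Z ≤ Z' →
          ∃ k : Z' ≃ₜ Z', (∀ (s : ℝ) (z w : Z'), (w : X) = σ s z → (k w : X) = σ s (k z)) ∧
            ∀ z : Z', (z : X) ∈ Γ → h z = k z := by
  have hEd : Differentiable ℝ E := hE.differentiable one_ne_zero
  obtain ⟨V, hVL, hVe, hVp, hVZ⟩ := exists_pseudogradient hσ hE hinv hF hFi h0F hb hbF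
  have hnL : LocallyLipschitz fun x => -V x := hVL.neg
  have hnb : ∀ x, ‖-V x‖ ≤ 1 := fun x => by rw [norm_neg]; exact (hVp x).1
  obtain ⟨φ, hφ⟩ := exists_isFlowOf hnL hnb
  have hd : ∀ x t, HasDerivAt (fun s => E (φ s x)) (-(fderiv ℝ E (φ t x) (V (φ t x)))) t := by
    intro x t
    have := (hEd (φ t x)).hasFDerivAt.comp_hasDerivAt t (hφ.hasDerivAt x t)
    rwa [map_neg] at this
  have hanti : ∀ x, Antitone fun s => E (φ s x) := fun x =>
    antitone_of_hasDerivAt_nonpos (fun t => hd x t) fun t => neg_nonpos.2 (hVp _).2.1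
  refine ⟨hφ.toHomeomorph hnL τ, fun s x => ?_, ?_, fun x => ?_, fun x hx => ?_, ?_⟩
  · exact hφ.map_comm hnL (σ s).toContinuousLinearMap
      (fun x => by simp [hVe]) τ x
  · have := hφ.eq_of_integralCurve hnL (γ := fun _ => 0)
      (fun t => by simpa [(hVp 0).2.2.2 rfl] using hasDerivAt_const t (0 : X)) τ
    exact this.symm
  · exact (hanti x hτ).trans_eq (congrArg E (hφ.zero x))
  · change E (φ τ x) ≤ _
    by_contra! hlt
    have hmem : ∀ t ∈ Set.Icc 0 τ, φ t x ∈ F := by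
      intro t ht
      have h1 := hanti x ht.2
      have h2 := hanti x ht.1
      simp only [hφ.zero] at h1 h2
      refine hx _ ?_ (by linarith) h2
      have h3 := hφ.dist_le hnb 0 t x
      rw [hφ.zero, one_mul, sub_zero, Real.norm_of_nonneg ht.1] at h3
      exact h3.trans ht.2
    have hanti2 : AntitoneOn (fun t => E (φ t x) + b / 2 * t) (Set.Icc 0 τ) := by
      have hd2 : ∀ t, HasDerivAt (fun t => E (φ t x) + b / 2 * t)
          (-(fderiv ℝ E (φ t x) (V (φ t x))) + b / 2) t := fun t =>
        (hd x t).add (by simpa using (hasDerivAt_id t).const_mul (b / 2))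
      refine antitoneOn_of_deriv_nonpos (convex_Icc 0 τ)
        (fun t _ => (hd2 t).continuousAt.continuousWithinAt)
        (fun t _ => (hd2 t).differentiableAt.differentiableWithinAt) fun t ht => ?_
      rw [(hd2 t).deriv]
      have := (hVp _).2.2.1 (hmem t (interior_subset ht))
      linarith
    have := hanti2 (Set.left_mem_Icc.2 hτ) (Set.right_mem_Icc.2 hτ) hτ
    simp only [hφ.zero] at this
    linarith
  · intro Y Γ hY hΓ hΓY
    set D : Set X := (fun p : ℝ × X => φ p.1 p.2) '' (Set.Icc 0 τ ×ˢ Γ) with hD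
    have hDc : IsCompact D := (isCompact_Icc.prod hΓ).image (hφ.continuous_uncurry hnL hnb)
    obtain ⟨Z, hZ, hZD⟩ : ∃ Z, σ.IsFinInvariant Z ∧ ∀ z ∈ D, V z ∈ Z := by
      refine hDc.induction_on (p := fun S => ∃ Z, σ.IsFinInvariant Z ∧ ∀ z ∈ S, V z ∈ Z)
        ⟨⊥, isFinInvariant_bot, by simp⟩ ?_ ?_ ?_
      · rintro S S' hS ⟨Z, hZ, h⟩
        exact ⟨Z, hZ, fun z hz => h z (hS hz)⟩
      · rintro S S' ⟨Z, hZ, h⟩ ⟨Z', hZ', h'⟩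
        refine ⟨Z ⊔ Z', hZ.sup hZ', ?_⟩
        rintro z (hz | hz)
        exacts [Submodule.mem_sup_left (h z hz), Submodule.mem_sup_right (h' z hz)]
      · intro y _
        obtain ⟨Z, hZ, h⟩ := hVZ y
        exact ⟨_, mem_nhdsWithin_of_mem_nhds h, Z, hZ, fun z hz => hz⟩
    -- Along the trajectories that start in `Γ` the field takes values in `Z`, so the flow of its
    -- projection to a larger invariant subspace has the same trajectories.
    refine ⟨Y ⊔ Z, hY.sup hZ, le_sup_left, fun Z' hZ' hle => ?_⟩
    have := hZ'.1
    have hPL : LocallyLipschitz fun x : X => Z'.starProjection (-V x) :=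
      Z'.starProjection.lipschitz.locallyLipschitz.comp hnL
    have hWL : LocallyLipschitz fun z : Z' => Z'.orthogonalProjectionOnto (-V z) :=
      Z'.orthogonalProjectionOnto.lipschitz.locallyLipschitz.comp
        (hnL.comp (LipschitzWith.subtype_val _).locallyLipschitz)
    have hWb : ∀ z : Z', ‖Z'.orthogonalProjectionOnto (-V z)‖ ≤ 1 := fun z =>
      (Z'.norm_starProjection_apply_le _).trans (hnb z)
    obtain ⟨ψ, hψ⟩ := exists_isFlowOf hWL hWb
    refine ⟨hψ.toHomeomorph hWL τ, fun s z w hw => ?_, fun z hz => ?_⟩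
    · have hw' : w = σ.restrict Z' hZ'.2 s z := Subtype.ext hw
      have h1 := hψ.map_comm hWL (σ.restrict Z' hZ'.2 s).toContinuousLinearMap (fun x => by
        simp only [LinearIsometry.coe_toContinuousLinearMap, coe_restrict_apply, hVe,
          ← _root_.map_neg, orthogonalProjectionOnto_map hZ'.2]) τ z
      rw [hw']
      exact congrArg Subtype.val h1
    · have h1 : ∀ t ∈ Set.Icc 0 τ, HasDerivAt (fun t => φ t (z : X))
          (Z'.starProjection (-V (φ t z))) t := by
        intro t ht
        have h2 : -V (φ t z) ∈ Z' := Submodule.neg_mem _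
          (hle (Submodule.mem_sup_right (hZD _ ⟨(t, (z : X)), ⟨ht, hz⟩, rfl⟩)))
        rw [Submodule.starProjection_eq_self_iff.2 h2]
        exact hφ.hasDerivAt z t
      have h2 : ∀ t ∈ Set.Icc 0 τ, HasDerivAt (fun t => (ψ t z : X))
          (Z'.starProjection (-V (ψ t z))) t := fun t _ =>
        Z'.subtypeL.hasFDerivAt.comp_hasDerivAt t (hψ.hasDerivAt z t)
      exact integralCurve_eqOn_Icc hPL h1 h2 (by simp [hφ.zero, hψ.zero])
        (Set.right_mem_Icc.2 hτ)

end IsometryRep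

/-! ### Rotating functions: isometric action and point evaluation -/

section RotatingFunctions

variable {n : ℕ} {T : ℝ} {Q : Matrix.orthogonalGroup (Fin n) ℝ}

/-- The isometry of `ℝⁿ` given by an orthogonal matrix. -/
def rotIso (Q : Matrix.orthogonalGroup (Fin n) ℝ) :
    EuclideanSpace ℝ (Fin n) ≃ₗᵢ[ℝ] EuclideanSpace ℝ (Fin n) :=
  LinearIsometry.toLinearIsometryEquiv
    ((Matrix.toEuclideanLin Q.1).isometryOfInner fun v w => by
      rw [← LinearMap.adjoint_inner_right, ← Matrix.toEuclideanLin_conjTranspose_eq_adjoint]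
      congr 1
      have : Q.1.transpose * Q.1 = 1 := (Matrix.mem_orthogonalGroup_iff' _ _).1 Q.2
      simp [Matrix.toLpLin_apply, Matrix.mulVec_mulVec, this]) rfl

theorem coe_shift (s : ℝ) (x : RotSpace n T Q) : ⇑(shift s x) = fun t => x (t + s) := rfl

theorem shift_add (s t : ℝ) (x : RotSpace n T Q) : shift (s + t) x = shift s (shift t x) :=
  RotSpace.ext fun r => congrArg x (by ring)

theorem shift_zero (x : RotSpace n T Q) : shift 0 x = x :=
  RotSpace.ext fun r => congrArg x (add_zero r)

theorem deriv_shift (s : ℝ) (x : RotSpace n T Q) (t : ℝ) :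
    deriv (shift s x) t = deriv x (t + s) := by
  rw [coe_shift, deriv_comp_add_const]

namespace RotSpace

theorem apply_add_period' (x : RotSpace n T Q) (t : ℝ) : x (t + T) = rotIso Q (x t) :=
  x.apply_add_period t

/-- The derivative is a rotating function, too; this also holds where the derivative is the junk
value `0`. -/
theorem deriv_add_period (x : RotSpace n T Q) (t : ℝ) :
    deriv x (t + T) = rotIso Q (deriv x t) := by
  have h1 : (fun s => x (s + T)) = rotIso Q ∘ x := funext x.apply_add_period'
  rw [← deriv_comp_add_const, h1, ← fderiv_apply_one_eq_deriv, LinearIsometryEquiv.comp_fderiv]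
  rfl

/-- The action is isometric, since the integrand of the inner product is periodic. -/
theorem h1Inner_shift (s : ℝ) (x y : RotSpace n T Q) :
    h1Inner (shift s x) (shift s y) = h1Inner x y := by
  set F : ℝ → ℝ := fun t => inner ℝ (x t) (y t) + inner ℝ (deriv x t) (deriv y t) with hF
  have hper : Function.Periodic F T := fun t => by
    simp only [hF, apply_add_period', deriv_add_period, LinearIsometryEquiv.inner_map_map]
  have h1 : h1Inner (shift s x) (shift s y) = ∫ t in (0 : ℝ)..T, F (t + s) := by
    refine intervalIntegral.integral_congr fun t _ => ?_
    simp only [hF, deriv_shift]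
    rfl
  rw [h1, intervalIntegral.integral_comp_add_right, zero_add, add_comm T s,
    hper.intervalIntegral_add_eq s 0, zero_add]
  rfl

theorem ae_hasDerivAt_primitive {g : ℝ → EuclideanSpace ℝ (Fin n)}
    (hg : ∀ a b : ℝ, MemLp g 2 (volume.restrict (Set.Ioc a b))) {x : ℝ → EuclideanSpace ℝ (Fin n)}
    (hx : ∀ t, x t = x 0 + ∫ s in (0 : ℝ)..t, g s) : ∀ᵐ t : ℝ, HasDerivAt x (g t) t := by
  have hloc : LocallyIntegrable g volume := fun t =>
    ⟨Set.Ioc (t - 1) (t + 1), Ioc_mem_nhds (by linarith) (by linarith),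
      (hg _ _).integrable (by norm_num)⟩
  filter_upwards [LocallyIntegrable.ae_hasDerivAt_integral hloc] with t ht
  have := (ht 0).const_add (x 0)
  rwa [← funext hx] at this

theorem integral_deriv (x : RotSpace n T Q) (a b : ℝ) :
    ∫ t in a..b, deriv x t = x b - x a := by
  obtain ⟨g, hg, hx⟩ := x.isH1Loc
  have hi := intervalIntegrable_of_memLp hg
  have h1 : ∫ t in a..b, deriv x t = ∫ t in a..b, g t :=
    intervalIntegral.integral_congr_ae ((ae_hasDerivAt_primitive hg hx).mono
      fun t ht _ => ht.deriv)
  rw [h1, hx a, hx b, add_sub_add_left_eq_sub,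
    intervalIntegral.integral_interval_sub_left (hi 0 b) (hi 0 a)]

end RotSpace

theorem norm_sq_lp_two {F : Type*} [NormedAddCommGroup F] [InnerProductSpace ℝ F]
    (hT : 0 ≤ T) (f : Lp F 2 (volume.restrict (Set.Ioc 0 T))) :
    ‖f‖ ^ 2 = ∫ t in (0 : ℝ)..T, ‖f t‖ ^ 2 := by
  rw [← real_inner_self_eq_norm_sq, L2.inner_def, intervalIntegral.integral_of_le hT]
  simp only [real_inner_self_eq_norm_sq]

theorem integral_norm_le_sqrt_mul_sqrt {F : Type*} [NormedAddCommGroup F] {f : ℝ → F} {a b : ℝ}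
    (hab : a ≤ b) (hf : MemLp f 2 (volume.restrict (Set.Ioc a b))) :
    ∫ t in a..b, ‖f t‖ ≤ √(b - a) * √(∫ t in a..b, ‖f t‖ ^ 2) := by
  have h := integral_mul_le_Lp_mul_Lq_of_nonneg (μ := volume.restrict (Set.Ioc a b))
    (f := fun _ => 1) (g := fun t => ‖f t‖) Real.HolderConjugate.two_two
    (Eventually.of_forall fun _ => zero_le_one) (Eventually.of_forall fun _ => norm_nonneg _)
    (memLp_const 1) (by simpa using hf.norm)
  simp only [one_mul, Real.rpow_two] at h
  rw [intervalIntegral.integral_of_le hab, intervalIntegral.integral_of_le hab,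
    Real.sqrt_eq_rpow, Real.sqrt_eq_rpow]
  simpa [hab] using h

namespace RotSpace

theorem intervalIntegrable_norm_sq (x : RotSpace n T Q) (a b : ℝ) :
    IntervalIntegrable (fun t => ‖x t‖ ^ 2) volume a b :=
  (x.isH1Loc.continuous.norm.pow 2).intervalIntegrable _ _

theorem intervalIntegrable_norm_deriv_sq (x : RotSpace n T Q) (a b : ℝ) :
    IntervalIntegrable (fun t => ‖deriv x t‖ ^ 2) volume a b := by
  constructor <;>
  exact (memLp_two_iff_integrable_sq_norm (x.isH1Loc.deriv_spec.2 _ _).1).1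
    (x.isH1Loc.deriv_spec.2 _ _)

theorem intervalIntegrable_norm_deriv (x : RotSpace n T Q) (a b : ℝ) :
    IntervalIntegrable (fun t => ‖deriv x t‖) volume a b :=
  (intervalIntegrable_of_memLp x.isH1Loc.deriv_spec.2 a b).norm

theorem norm_sub_le_integral (x : RotSpace n T Q) {a b : ℝ} (hab : a ≤ b) :
    ‖x b - x a‖ ≤ ∫ t in a..b, ‖deriv x t‖ := by
  rw [← integral_deriv]
  exact intervalIntegral.norm_integral_le_integral_norm hab

variable [hT : Fact (0 < T)]

theorem norm_sq_eq (x : RotSpace n T Q) :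
    ‖x‖ ^ 2 = (∫ t in (0 : ℝ)..T, ‖x t‖ ^ 2) + ∫ t in (0 : ℝ)..T, ‖deriv x t‖ ^ 2 := by
  have h : ‖x‖ ^ 2 = h1Inner x x := (real_inner_self_eq_norm_sq x).symm
  rw [h, ← intervalIntegral.integral_add (x.intervalIntegrable_norm_sq _ _)
    (x.intervalIntegrable_norm_deriv_sq _ _)]
  refine intervalIntegral.integral_congr fun t _ => ?_
  simp only [real_inner_self_eq_norm_sq]

theorem integral_norm_sq_le (x : RotSpace n T Q) : ∫ t in (0 : ℝ)..T, ‖x t‖ ^ 2 ≤ ‖x‖ ^ 2 := by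
  rw [norm_sq_eq, le_add_iff_nonneg_right]
  exact intervalIntegral.integral_nonneg hT.out.le fun t _ => by positivity

theorem integral_norm_deriv_sq_le (x : RotSpace n T Q) :
    ∫ t in (0 : ℝ)..T, ‖deriv x t‖ ^ 2 ≤ ‖x‖ ^ 2 := by
  rw [norm_sq_eq, le_add_iff_nonneg_left]
  exact intervalIntegral.integral_nonneg hT.out.le fun t _ => by positivity

/-- Rotating `H¹` functions are Hölder continuous with exponent `1/2` on a period. -/
theorem norm_sub_le_sqrt_mul (x : RotSpace n T Q) {s t : ℝ} (hs : 0 ≤ s) (hst : s ≤ t)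
    (ht : t ≤ T) : ‖x t - x s‖ ≤ √(t - s) * ‖x‖ := by
  refine (x.norm_sub_le_integral hst).trans
    ((integral_norm_le_sqrt_mul_sqrt hst (x.isH1Loc.deriv_spec.2 _ _)).trans ?_)
  gcongr
  rw [Real.sqrt_le_left (norm_nonneg _)]
  refine le_trans ?_ x.integral_norm_deriv_sq_le
  exact intervalIntegral.integral_mono_interval hs hst ht
    (Eventually.of_forall fun t => by positivity) (x.intervalIntegrable_norm_deriv_sq _ _)

/-- Point evaluation is bounded: compare `x 0` with the mean of `x` over a period. -/
theorem norm_apply_zero_le (x : RotSpace n T Q) : ‖x 0‖ ≤ (√T / T + √T) * ‖x‖ := by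
  have hT0 := hT.out
  have h1 : ∀ t ∈ Set.Icc 0 T, ‖x 0‖ ≤ ‖x t‖ + √T * ‖x‖ := by
    intro t ht
    have h2 := x.norm_sub_le_sqrt_mul le_rfl ht.1 ht.2
    have h3 : √(t - 0) * ‖x‖ ≤ √T * ‖x‖ := by
      gcongr
      linarith [ht.2]
    have h4 := norm_sub_norm_le (x 0) (x t)
    rw [norm_sub_rev] at h4
    linarith
  have h2 : ∫ _t in (0 : ℝ)..T, ‖x 0‖ ≤ ∫ t in (0 : ℝ)..T, (‖x t‖ + √T * ‖x‖) :=
    intervalIntegral.integral_mono_on hT0.le (by simp)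
      ((x.isH1Loc.continuous.norm.add continuous_const).intervalIntegrable _ _) h1
  rw [intervalIntegral.integral_add (x.isH1Loc.continuous.norm.intervalIntegrable _ _) (by simp),
    intervalIntegral.integral_const, intervalIntegral.integral_const, sub_zero, smul_eq_mul,
    smul_eq_mul] at h2
  have h3 := integral_norm_le_sqrt_mul_sqrt hT0.le (x.memLp_coe 0 T)
  have h4 : √(∫ t in (0 : ℝ)..T, ‖x t‖ ^ 2) ≤ ‖x‖ := by
    rw [Real.sqrt_le_left (norm_nonneg _)]
    exact x.integral_norm_sq_le
  have h5 : √(T - 0) * √(∫ t in (0 : ℝ)..T, ‖x t‖ ^ 2) ≤ √T * ‖x‖ := by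
    rw [sub_zero]
    gcongr
  have h6 : T * ‖x 0‖ ≤ T * ((√T / T + √T) * ‖x‖) := by
    have : T * ((√T / T + √T) * ‖x‖) = √T * ‖x‖ + T * (√T * ‖x‖) := by field_simp
    rw [this]
    linarith
  exact le_of_mul_le_mul_left h6 hT0

end RotSpace

section

variable [hT : Fact (0 < T)]

/-- The action of time `s` as a linear isometry. -/
def shiftIsometry (s : ℝ) : RotSpace n T Q →ₗᵢ[ℝ] RotSpace n T Q where
  toFun := shift s
  map_add' _ _ := rfl
  map_smul' _ _ := rfl
  norm_map' x := by
    change ‖shift s x‖ = ‖x‖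
    have h : ‖shift s x‖ ^ 2 = ‖x‖ ^ 2 := by
      rw [← real_inner_self_eq_norm_sq, ← real_inner_self_eq_norm_sq]
      exact RotSpace.h1Inner_shift s x x
    exact (pow_left_inj₀ (norm_nonneg _) (norm_nonneg _) two_ne_zero).1 h

theorem shiftIsometry_apply (s : ℝ) (x : RotSpace n T Q) : shiftIsometry s x = shift s x := rfl

/-- Evaluation at time `t`, which is continuous since `H¹` embeds into the continuous functions. -/
def evalCLM (t : ℝ) : RotSpace n T Q →L[ℝ] EuclideanSpace ℝ (Fin n) :=
  LinearMap.mkContinuous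
    { toFun := fun x => x t
      map_add' := fun _ _ => rfl
      map_smul' := fun _ _ => rfl } (√T / T + √T) fun x => by
    change ‖x t‖ ≤ _
    have h := (shift t x).norm_apply_zero_le
    rw [← shiftIsometry_apply, LinearIsometry.norm_map, shiftIsometry_apply, coe_shift] at h
    simpa using h

theorem evalCLM_apply (t : ℝ) (x : RotSpace n T Q) : evalCLM t x = x t := rfl

theorem norm_evalCLM_sub_le {s t : ℝ} (hs : s ∈ Set.Icc 0 T) (ht : t ∈ Set.Icc 0 T) :
    ‖(evalCLM t : RotSpace n T Q →L[ℝ] _) - evalCLM s‖ ≤ √|t - s| := by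
  refine ContinuousLinearMap.opNorm_le_bound _ (Real.sqrt_nonneg _) fun x => ?_
  rw [_root_.sub_apply, evalCLM_apply, evalCLM_apply]
  rcases le_total s t with h | h
  · rw [abs_of_nonneg (sub_nonneg.2 h)]
    exact x.norm_sub_le_sqrt_mul hs.1 h ht.2
  · rw [abs_sub_comm, abs_of_nonneg (sub_nonneg.2 h), norm_sub_rev]
    exact x.norm_sub_le_sqrt_mul ht.1 h hs.2

theorem continuousOn_evalCLM :
    ContinuousOn (fun t => (evalCLM t : RotSpace n T Q →L[ℝ] _)) (Set.Icc 0 T) := by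
  intro s hs
  refine (tendsto_iff_norm_sub_tendsto_zero
    (E := RotSpace n T Q →L[ℝ] EuclideanSpace ℝ (Fin n))).2 ?_
  refine squeeze_zero' (Eventually.of_forall fun _ => by positivity)
    (eventually_mem_nhdsWithin.mono fun t ht => norm_evalCLM_sub_le hs ht) ?_
  have hc : Continuous fun t : ℝ => √|t - s| := by fun_prop
  simpa using (hc.tendsto s).mono_left nhdsWithin_le_nhds

end

/-! ### Completeness of the space of rotating functions -/

section Completeness

/-- The extension of `g : [0, T) → ℝⁿ` to a function on `ℝ` with `g (t + T) = Q g (t)`. -/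
def rotExtend (T : ℝ) (Q : Matrix.orthogonalGroup (Fin n) ℝ) (g : ℝ → EuclideanSpace ℝ (Fin n))
    (t : ℝ) : EuclideanSpace ℝ (Fin n) :=
  (rotIso Q ^ ⌊t / T⌋) (g (t - ⌊t / T⌋ * T))

variable {g : ℝ → EuclideanSpace ℝ (Fin n)}

theorem measurable_rotExtend (hg : Measurable g) : Measurable (rotExtend T Q g) := by
  have h1 : Measurable fun p : ℝ × ℤ => (rotIso Q ^ p.2) (g (p.1 - p.2 * T)) :=
    measurable_from_prod_countable_left fun k =>
      (rotIso Q ^ k).continuous.measurable.comp (hg.comp (measurable_id.sub_const ((k : ℝ) * T)))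
  exact h1.comp (measurable_id.prodMk (Int.measurable_floor.comp (measurable_id.div_const T)))

variable [hT : Fact (0 < T)]

theorem rotExtend_add_period (t : ℝ) :
    rotExtend T Q g (t + T) = rotIso Q (rotExtend T Q g t) := by
  have h : ⌊(t + T) / T⌋ = ⌊t / T⌋ + 1 := by
    rw [add_div, div_self hT.out.ne', Int.floor_add_one]
  unfold rotExtend
  rw [h, zpow_add_one, (Commute.zpow_self (rotIso Q) _).eq]
  change rotIso Q ((rotIso Q ^ ⌊t / T⌋) _) = _
  congr 3
  push_cast
  ring

theorem rotExtend_eq_of_mem {t : ℝ} (ht : t ∈ Set.Ico 0 T) : rotExtend T Q g t = g t := by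
  have h : ⌊t / T⌋ = 0 := by
    rw [Int.floor_eq_zero_iff]
    exact ⟨div_nonneg ht.1 hT.out.le, (div_lt_one hT.out).2 ht.2⟩
  simp [rotExtend, h]

theorem rotExtend_ae_eq : rotExtend T Q g =ᵐ[volume.restrict (Set.Ioc 0 T)] g := by
  rw [← Measure.restrict_congr_set Ico_ae_eq_Ioc]
  exact (ae_restrict_iff' measurableSet_Ico).2 (Eventually.of_forall fun t ht =>
    rotExtend_eq_of_mem ht)

theorem memLp_rotExtend (hg : Measurable g) (hg2 : MemLp g 2 (volume.restrict (Set.Ioc 0 T)))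
    (a b : ℝ) : MemLp (rotExtend T Q g) 2 (volume.restrict (Set.Ioc a b)) := by
  have hm := measurable_rotExtend (T := T) (Q := Q) hg
  rw [memLp_two_iff_integrable_sq_norm hm.aestronglyMeasurable]
  have hper : Function.Periodic (fun t => ‖rotExtend T Q g t‖ ^ 2) T := fun t => by
    simp only [rotExtend_add_period, LinearIsometryEquiv.norm_map]
  have h0 : IntervalIntegrable (fun t => ‖rotExtend T Q g t‖ ^ 2) volume 0 T := by
    rw [intervalIntegrable_iff_integrableOn_Ioc_of_le hT.out.le]
    exact (memLp_two_iff_integrable_sq_norm hm.aestronglyMeasurable).1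
      ((memLp_congr_ae (rotExtend_ae_eq (T := T) (Q := Q) (g := g))).2 hg2)
  exact (hper.intervalIntegrable₀ hT.out.ne' h0 a b).1

/-- Any initial value and any square integrable derivative on a period that lead to the right final
value come from a rotating `H¹` function. -/
theorem exists_rotSpace (a : EuclideanSpace ℝ (Fin n)) (hg : Measurable g)
    (hg2 : MemLp g 2 (volume.restrict (Set.Ioc 0 T)))
    (ha : a + ∫ t in (0 : ℝ)..T, g t = rotIso Q a) :
    ∃ x : RotSpace n T Q, x 0 = a ∧ deriv x =ᵐ[volume.restrict (Set.Ioc 0 T)] g := by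
  set G := rotExtend T Q g with hG
  have hGm := memLp_rotExtend (Q := Q) hg hg2
  have hi := intervalIntegrable_of_memLp hGm
  set x : ℝ → EuclideanSpace ℝ (Fin n) := fun t => a + ∫ s in (0 : ℝ)..t, G s with hx
  have hx0 : x 0 = a := by simp [hx]
  have hxp : ∀ t, x t = x 0 + ∫ s in (0 : ℝ)..t, G s := fun t => by rw [hx0]
  have hGT : ∫ s in (0 : ℝ)..T, G s = ∫ s in (0 : ℝ)..T, g s := by
    rw [intervalIntegral.integral_of_le hT.out.le, intervalIntegral.integral_of_le hT.out.le]
    exact integral_congr_ae rotExtend_ae_eq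
  have hrot : ∀ t, x (t + T) = rotIso Q (x t) := by
    intro t
    have h1 : ∫ s in (T : ℝ)..(t + T), G s = rotIso Q (∫ s in (0 : ℝ)..t, G s) := by
      have h2 := intervalIntegral.integral_comp_add_right (a := 0) (b := t) G T
      rw [zero_add] at h2
      rw [← h2]
      simp only [hG, rotExtend_add_period]
      exact ContinuousLinearMap.intervalIntegral_comp_comm
        (rotIso Q).toContinuousLinearEquiv.toContinuousLinearMap (hi 0 t)
    simp only [hx]
    rw [← intervalIntegral.integral_add_adjacent_intervals (hi 0 T) (hi T (t + T)), hGT, h1,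
      ← add_assoc, ha, _root_.map_add]
  refine ⟨⟨x, ⟨G, hGm, hxp⟩, hrot⟩, hx0, ?_⟩
  refine EventuallyEq.trans ?_ (rotExtend_ae_eq (T := T) (Q := Q) (g := g))
  exact ae_restrict_of_ae ((RotSpace.ae_hasDerivAt_primitive hGm hxp).mono fun t ht => ht.deriv)

/-- The class of `x'` in `L²(0, T)`. -/
def derivL2 : RotSpace n T Q →ₗ[ℝ]
    Lp (EuclideanSpace ℝ (Fin n)) 2 (volume.restrict (Set.Ioc 0 T)) where
  toFun x := (x.isH1Loc.deriv_spec.2 0 T).toLp (deriv x)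
  map_add' x y := by
    rw [← MemLp.toLp_add, MemLp.toLp_eq_toLp_iff]
    refine ae_restrict_of_ae ?_
    filter_upwards [x.isH1Loc.deriv_spec.1, y.isH1Loc.deriv_spec.1] with t hx hy
    rw [RotSpace.coe_add, deriv_add hx hy, Pi.add_apply]
  map_smul' c x := by
    rw [RingHom.id_apply, ← MemLp.toLp_const_smul, MemLp.toLp_eq_toLp_iff]
    refine ae_restrict_of_ae ?_
    filter_upwards [x.isH1Loc.deriv_spec.1] with t hx
    rw [RotSpace.coe_smul, deriv_const_smul c hx, Pi.smul_apply]

theorem norm_sq_derivL2 (x : RotSpace n T Q) :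
    ‖derivL2 x‖ ^ 2 = ∫ t in (0 : ℝ)..T, ‖deriv x t‖ ^ 2 := by
  rw [norm_sq_lp_two hT.out.le, intervalIntegral.integral_of_le hT.out.le,
    intervalIntegral.integral_of_le hT.out.le]
  refine integral_congr_ae ?_
  filter_upwards [(x.isH1Loc.deriv_spec.2 0 T).coeFn_toLp] with t ht
  exact congrArg (fun v => ‖v‖ ^ 2) ht

/-- The integral `∫₀ᵀ g`, as a functional on `L²(0, T)`. -/
def integralL2 (n : ℕ) (hT : 0 ≤ T) : Lp (EuclideanSpace ℝ (Fin n)) 2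
    (volume.restrict (Set.Ioc 0 T)) →L[ℝ] EuclideanSpace ℝ (Fin n) :=
  LinearMap.mkContinuous
    { toFun := fun f => ∫ t in (0 : ℝ)..T, f t
      map_add' := fun f g => by
        simp only [intervalIntegral.integral_of_le hT]
        rw [← integral_add ((Lp.memLp f).integrable (by norm_num))
          ((Lp.memLp g).integrable (by norm_num))]
        exact integral_congr_ae (Lp.coeFn_add f g)
      map_smul' := fun c f => by
        simp only [intervalIntegral.integral_of_le hT, RingHom.id_apply]
        rw [← integral_smul]
        exact integral_congr_ae (Lp.coeFn_smul c f) } √T fun f => by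
    refine (intervalIntegral.norm_integral_le_integral_norm hT).trans
      ((integral_norm_le_sqrt_mul_sqrt hT (Lp.memLp f)).trans ?_)
    rw [← norm_sq_lp_two hT, Real.sqrt_sq (norm_nonneg _), sub_zero]

/-- The initial value and the derivative of a rotating function. -/
def initDeriv : RotSpace n T Q →L[ℝ] EuclideanSpace ℝ (Fin n) ×
    Lp (EuclideanSpace ℝ (Fin n)) 2 (volume.restrict (Set.Ioc 0 T)) :=
  (evalCLM 0).prod (derivL2.mkContinuous 1 fun x => by
    rw [one_mul]
    refine (pow_le_pow_iff_left₀ (norm_nonneg _) (norm_nonneg _) two_ne_zero).1 ?_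
    rw [norm_sq_derivL2]
    exact x.integral_norm_deriv_sq_le)

theorem initDeriv_apply (x : RotSpace n T Q) : initDeriv x = (x 0, derivL2 x) := rfl

/-- The pairs of initial value and derivative form a closed subspace, cut out by the condition that
the value at time `T` is the rotated initial value. -/
theorem range_initDeriv :
    Set.range (initDeriv : RotSpace n T Q →L[ℝ] _) =
      {p | p.1 + integralL2 n hT.out.le p.2 = rotIso Q p.1} := by
  ext ⟨a, f⟩
  constructor
  · rintro ⟨x, hx⟩
    rw [initDeriv_apply, Prod.mk.injEq] at hx
    obtain ⟨rfl, rfl⟩ := hx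
    have h1 : ∫ t in (0 : ℝ)..T, derivL2 x t = ∫ t in (0 : ℝ)..T, deriv x t := by
      rw [intervalIntegral.integral_of_le hT.out.le, intervalIntegral.integral_of_le hT.out.le]
      exact integral_congr_ae (x.isH1Loc.deriv_spec.2 0 T).coeFn_toLp
    have h2 := x.apply_add_period' 0
    rw [zero_add] at h2
    change x 0 + ∫ t in (0 : ℝ)..T, derivL2 x t = rotIso Q (x 0)
    rw [h1, RotSpace.integral_deriv, h2, add_sub_cancel]
  · intro h
    obtain ⟨x, hx0, hx⟩ := exists_rotSpace a (Lp.stronglyMeasurable f).measurable (Lp.memLp f) h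
    refine ⟨x, ?_⟩
    rw [initDeriv_apply, hx0]
    congr 1
    exact Lp.ext ((x.isH1Loc.deriv_spec.2 0 T).coeFn_toLp.trans hx)

theorem norm_le_initDeriv (x : RotSpace n T Q) :
    ‖x‖ ≤ (√T * (1 + √T) + 1) * ‖initDeriv x‖ := by
  have hT0 := hT.out
  set N := ‖initDeriv x‖ with hN
  have h0 : ‖x 0‖ ≤ N := by
    rw [hN, initDeriv_apply]
    exact le_max_left _ _
  have h1 : ‖derivL2 x‖ ≤ N := by
    rw [hN, initDeriv_apply]
    exact le_max_right _ _
  have h2 : ∀ t ∈ Set.Icc 0 T, ‖x t‖ ^ 2 ≤ ((1 + √T) * N) ^ 2 := by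
    intro t ht
    have h3 : ‖x t - x 0‖ ≤ √T * ‖derivL2 x‖ := by
      refine (x.norm_sub_le_integral ht.1).trans ?_
      refine le_trans (intervalIntegral.integral_mono_interval le_rfl ht.1 ht.2
        (Eventually.of_forall fun t => norm_nonneg _) (x.intervalIntegrable_norm_deriv _ _)) ?_
      refine (integral_norm_le_sqrt_mul_sqrt hT0.le (x.isH1Loc.deriv_spec.2 _ _)).trans ?_
      rw [← norm_sq_derivL2, Real.sqrt_sq (norm_nonneg _), sub_zero]
    have h4 : ‖x t‖ ≤ ‖x 0‖ + ‖x t - x 0‖ := norm_le_insert' _ _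
    have h5 : √T * ‖derivL2 x‖ ≤ √T * N := by gcongr
    have h6 : ‖x t‖ ≤ (1 + √T) * N := by linarith
    gcongr
  have h3 : ∫ t in (0 : ℝ)..T, ‖x t‖ ^ 2 ≤ T * ((1 + √T) * N) ^ 2 := by
    have := intervalIntegral.integral_mono_on hT0.le (x.intervalIntegrable_norm_sq 0 T)
      (by simp) h2
    simpa using this
  have hNn : 0 ≤ N := norm_nonneg _
  refine (pow_le_pow_iff_left₀ (norm_nonneg _) (by positivity) two_ne_zero).1 ?_
  rw [RotSpace.norm_sq_eq, ← norm_sq_derivL2]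
  have h4 : ‖derivL2 x‖ ^ 2 ≤ N ^ 2 := by gcongr
  have h5 : 0 ≤ √T * (1 + √T) * N * N := by positivity
  have h6 : T * ((1 + √T) * N) ^ 2 = (√T * (1 + √T) * N) ^ 2 := by
    rw [mul_assoc, mul_pow √T, Real.sq_sqrt hT0.le]
  nlinarith

/-- `X` embeds, with equivalent norms, onto a closed subspace of `ℝⁿ × L²(0, T)`. -/
instance : CompleteSpace (RotSpace n T Q) := by
  have hA : AntilipschitzWith (.mk (√T * (1 + √T) + 1) (by positivity))
      (initDeriv : RotSpace n T Q →L[ℝ] _) :=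
    ContinuousLinearMap.antilipschitz_of_bound _ norm_le_initDeriv
  rw [completeSpace_iff_isComplete_range
    (hA.isUniformInducing (initDeriv : RotSpace n T Q →L[ℝ] _).uniformContinuous), range_initDeriv]
  refine IsClosed.isComplete (isClosed_eq ?_ ?_)
  · exact continuous_fst.add ((integralL2 n hT.out.le).continuous.comp continuous_snd)
  · exact (rotIso Q).continuous.comp continuous_fst

end Completeness

end RotatingFunctions

/-! ### The Gram operator and the finite dimensional invariant subspaces -/

section Gram

variable {X F : Type*} [NormedAddCommGroup X] [InnerProductSpace ℝ X] [CompleteSpace X]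
  [NormedAddCommGroup F] [InnerProductSpace ℝ F] [FiniteDimensional ℝ F] {T : ℝ}
  {e : ℝ → X →L[ℝ] F}

/-- The operator that represents the form `(x, y) ↦ ∫₀ᵀ ⟪e t x, e t y⟫`. -/
def gramOperator (e : ℝ → X →L[ℝ] F) (T : ℝ) : X →L[ℝ] X :=
  ∫ t in (0 : ℝ)..T, ContinuousLinearMap.adjoint (e t) ∘L e t

theorem intervalIntegrable_adjoint_comp (hT : 0 ≤ T) (he : ContinuousOn e (Set.Icc 0 T)) :
    IntervalIntegrable (fun t => ContinuousLinearMap.adjoint (e t) ∘L e t) volume 0 T :=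
  ContinuousOn.intervalIntegrable_of_Icc hT
    ((ContinuousLinearMap.adjoint.continuous.comp_continuousOn he).clm_comp he)

theorem inner_gramOperator (hT : 0 ≤ T) (he : ContinuousOn e (Set.Icc 0 T)) (x y : X) :
    inner ℝ (gramOperator e T x) y = ∫ t in (0 : ℝ)..T, inner ℝ (e t x) (e t y) := by
  have h := ContinuousLinearMap.intervalIntegral_comp_comm
    ((innerSL ℝ y).comp (ContinuousLinearMap.apply ℝ X x)) (intervalIntegrable_adjoint_comp hT he)
  rw [real_inner_comm]
  refine Eq.trans h.symm (intervalIntegral.integral_congr fun t _ => ?_)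
  change inner ℝ y (ContinuousLinearMap.adjoint (e t) (e t x)) = _
  rw [ContinuousLinearMap.adjoint_inner_right, real_inner_comm]

/-- The operators `(e t)† ∘ e t` have finite rank, and the compact operators are a closed convex
set. -/
theorem isCompactOperator_gramOperator (hT : 0 < T) (he : ContinuousOn e (Set.Icc 0 T)) :
    IsCompactOperator (gramOperator e T) := by
  have hcl : IsClosed {A : X →L[ℝ] X | IsCompactOperator A} :=
    isClosed_setOfPred_isCompactOperator
  have hconv : Convex ℝ {A : X →L[ℝ] X | IsCompactOperator A} :=
    fun A hA B hB a b _ _ _ => (hA.smul a).add (hB.smul b)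
  have : ProperSpace F := FiniteDimensional.proper_real F
  have hmem : ∀ t, ContinuousLinearMap.adjoint (e t) ∘L e t ∈
      {A : X →L[ℝ] X | IsCompactOperator A} := fun t =>
    (isCompactOperator_of_locallyCompactSpace_dom (e t)).clm_comp
      (ContinuousLinearMap.adjoint (e t))
  have havg := hconv.set_average_mem hcl (μ := volume) (t := Set.Ioc 0 T)
    (by simp [hT]) (by simp) (Eventually.of_forall hmem)
    (intervalIntegrable_adjoint_comp hT.le he).1
  have h : gramOperator e T = (volume.real (Set.Ioc 0 T)) •
      ⨍ t in Set.Ioc 0 T, ContinuousLinearMap.adjoint (e t) ∘L e t := by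
    rw [gramOperator, intervalIntegral.integral_of_le hT.le, measure_smul_setAverage _ (by simp)]
  rw [h]
  exact IsCompactOperator.smul havg _

end Gram

section GramRotSpace

variable {n : ℕ} {T : ℝ} {Q : Matrix.orthogonalGroup (Fin n) ℝ} [hT : Fact (0 < T)]

variable (n T Q) in
/-- The operator on `X` that represents the `L²` inner product in the `H¹` inner product. -/
def gram : RotSpace n T Q →L[ℝ] RotSpace n T Q := gramOperator evalCLM T

theorem inner_gram (x y : RotSpace n T Q) :
    inner ℝ (gram n T Q x) y = ∫ t in (0 : ℝ)..T, inner ℝ (x t) (y t) :=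
  inner_gramOperator hT.out.le continuousOn_evalCLM x y

theorem isSymmetric_gram :
    (gram n T Q : RotSpace n T Q →ₗ[ℝ] RotSpace n T Q).IsSymmetric := by
  intro x y
  change inner ℝ (gram n T Q x) y = inner ℝ x (gram n T Q y)
  rw [inner_gram, real_inner_comm, inner_gram]
  simp only [real_inner_comm]

theorem isCompactOperator_gram : IsCompactOperator (gram n T Q) :=
  isCompactOperator_gramOperator hT.out continuousOn_evalCLM

theorem eq_zero_of_gram_eq_zero {x : RotSpace n T Q} (h : gram n T Q x = 0) : x = 0 := by
  have h1 := inner_gram x x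
  rw [h, inner_zero_left] at h1
  refine RotSpace.eq_zero_of_Icc hT.out x fun t ht => ?_
  have hc : Continuous fun t => (inner ℝ (x t) (x t) : ℝ) :=
    x.isH1Loc.continuous.inner x.isH1Loc.continuous
  have h2 := (intervalIntegral.integral_eq_zero_iff_of_le_of_nonneg_ae hT.out.le
    (Eventually.of_forall fun t => real_inner_self_nonneg) (hc.intervalIntegrable 0 T)).1 h1.symm
  rw [Measure.restrict_congr_set Ioc_ae_eq_Icc] at h2
  exact inner_self_eq_zero.1 (Measure.eqOn_Icc_of_ae_eq volume hT.out.ne h2 hc.continuousOn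
    continuousOn_const ht)

theorem inner_shift_left (s : ℝ) (x y : RotSpace n T Q) :
    inner ℝ (shift s x) y = inner ℝ x (shift (-s) y) := by
  have h : shift s (shift (-s) y) = y := by rw [← shift_add, add_neg_cancel, shift_zero]
  conv_lhs => rw [← h]
  exact (shiftIsometry s).inner_map_map _ _

theorem gram_shift (s : ℝ) (x : RotSpace n T Q) :
    gram n T Q (shift s x) = shift s (gram n T Q x) := by
  refine ext_inner_right ℝ fun y => ?_
  rw [inner_shift_left, inner_gram, inner_gram]
  set F : ℝ → ℝ := fun t => inner ℝ (x t) (y (t - s)) with hF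
  have hper : Function.Periodic F T := fun t => by
    simp only [hF]
    rw [show t + T - s = t - s + T by ring, RotSpace.apply_add_period',
      RotSpace.apply_add_period', LinearIsometryEquiv.inner_map_map]
  have h1 : ∀ t, inner ℝ (shift s x t) (y t) = F (t + s) := fun t => by
    simp only [hF, add_sub_cancel_right]
    rfl
  simp only [h1]
  rw [intervalIntegral.integral_comp_add_right, zero_add, add_comm T s,
    hper.intervalIntegral_add_eq s 0, zero_add]
  rfl

theorem denseRange_gram : DenseRange (gram n T Q) := by
  have h : (LinearMap.range (gram n T Q : RotSpace n T Q →ₗ[ℝ] RotSpace n T Q))ᗮ = ⊥ := by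
    rw [Submodule.eq_bot_iff]
    intro x hx
    refine eq_zero_of_gram_eq_zero (inner_self_eq_zero.1 (?_ : inner ℝ _ (gram n T Q x) = 0))
    have h1 := (Submodule.mem_orthogonal _ x).1 hx (gram n T Q (gram n T Q x)) ⟨_, rfl⟩
    rw [← h1]
    exact (isSymmetric_gram (gram n T Q x) x).symm
  rw [← Submodule.topologicalClosure_eq_top_iff] at h
  exact Submodule.dense_iff_topologicalClosure_eq_top.2 h

theorem norm_shift (s : ℝ) (x : RotSpace n T Q) : ‖shift s x‖ = ‖x‖ :=
  (shiftIsometry s).norm_map x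

/-- Weak continuity of the action. It is plain against vectors in the range of `gram`, where the
inner product is an `L²` one, and this range is dense. -/
theorem continuous_inner_shift (x z : RotSpace n T Q) :
    Continuous fun s : ℝ => (inner ℝ (shift s x) z : ℝ) := by
  refine continuous_of_uniform_approx_of_continuous fun u hu => ?_
  obtain ⟨ε, hε, hu⟩ := Metric.mem_uniformity_dist.1 hu
  obtain ⟨y, hy⟩ := denseRange_gram.exists_dist_lt z (div_pos hε (by positivity : 0 < ‖x‖ + 1))
  refine ⟨fun s => inner ℝ (shift s x) (gram n T Q y), ?_, fun s => hu ?_⟩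
  · have h : ∀ s, inner ℝ (shift s x) (gram n T Q y) =
        ∫ t in (0 : ℝ)..T, inner ℝ (y t) (x (t + s)) := fun s => by
      rw [real_inner_comm, inner_gram]
      rfl
    simp only [h]
    refine intervalIntegral.continuous_parametric_intervalIntegral_of_continuous' ?_ 0 T
    have hx := x.isH1Loc.continuous
    have hy := y.isH1Loc.continuous
    exact (hy.comp continuous_snd).inner (hx.comp (continuous_snd.add continuous_fst))
  · rw [Real.dist_eq, ← inner_sub_right]
    refine (abs_real_inner_le_norm _ _).trans_lt ?_
    rw [norm_shift, ← dist_eq_norm]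
    rw [lt_div_iff₀ (by positivity)] at hy
    nlinarith [norm_nonneg x, dist_nonneg (x := z) (y := gram n T Q y)]

/-- Strong continuity of the action, which follows from the weak one since it is isometric. -/
theorem continuous_shift (x : RotSpace n T Q) : Continuous fun s : ℝ => shift s x := by
  refine continuous_iff_continuousAt.2 fun r => ?_
  refine (tendsto_iff_norm_sub_tendsto_zero (E := RotSpace n T Q)).2 ?_
  have h1 : Tendsto (fun s => √(2 * ‖x‖ ^ 2 - 2 * inner ℝ (shift s x) (shift r x))) (𝓝 r)
      (𝓝 √(2 * ‖x‖ ^ 2 - 2 * inner ℝ (shift r x) (shift r x))) :=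
    (continuous_const.sub ((continuous_inner_shift x (shift r x)).const_mul 2)).sqrt.tendsto r
  rw [real_inner_self_eq_norm_sq, norm_shift, sub_self, Real.sqrt_zero] at h1
  refine h1.congr fun s => ?_
  have h2 := norm_sub_sq_real (shift s x) (shift r x)
  rw [norm_shift, norm_shift] at h2
  rw [← Real.sqrt_sq (norm_nonneg (shift s x - shift r x)), h2]
  congr 1
  ring

variable (n T Q) in
/-- The action `𝒬` as a strongly continuous group of linear isometries. -/
def shiftRep : IsometryRep (RotSpace n T Q) where
  map := shiftIsometry
  map_zero := shift_zero
  map_add := shift_add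
  continuous_orbit := continuous_shift

theorem shiftRep_apply (s : ℝ) (x : RotSpace n T Q) : shiftRep n T Q s x = shift s x := rfl

theorem isFinInvariant_eigenspace_gram {μ : ℝ} : (shiftRep n T Q).IsFinInvariant
    (Module.End.eigenspace (gram n T Q : RotSpace n T Q →ₗ[ℝ] RotSpace n T Q) μ) := by
  constructor
  · rcases eq_or_ne μ 0 with rfl | hμ
    · have : Module.End.eigenspace (gram n T Q : RotSpace n T Q →ₗ[ℝ] RotSpace n T Q) 0 = ⊥ := by
        rw [Submodule.eq_bot_iff]
        intro x hx
        rw [Module.End.mem_eigenspace_iff, zero_smul] at hx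
        exact eq_zero_of_gram_eq_zero hx
      rw [this]
      infer_instance
    · exact ContinuousLinearMap.finite_dimensional_eigenspace isCompactOperator_gram μ hμ
  · intro s x hx
    have hx1 := Module.End.mem_eigenspace_iff.1 hx
    refine Module.End.mem_eigenspace_iff.2 ?_
    change gram n T Q (shift s x) = μ • shift s x
    rw [gram_shift]
    change shift s ((gram n T Q : RotSpace n T Q →ₗ[ℝ] RotSpace n T Q) x) = _
    rw [hx1]
    rfl

/-- The eigenspaces of the compact, symmetric, injective operator `gram` are finite dimensional and
invariant, and they span a dense subspace. -/
theorem hasDenseFinInvariant_shiftRep : (shiftRep n T Q).HasDenseFinInvariant := by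
  intro x η hη
  have h := ContinuousLinearMap.orthogonalComplement_iSup_eigenspaces_eq_bot
    (isCompactOperator_gram (n := n) (T := T) (Q := Q)) isSymmetric_gram
  rw [← Submodule.topologicalClosure_eq_top_iff] at h
  obtain ⟨z, hz, hxz⟩ := (Submodule.dense_iff_topologicalClosure_eq_top.2 h).exists_dist_lt x hη
  rw [dist_eq_norm] at hxz
  have hfin : ∃ Z, (shiftRep n T Q).IsFinInvariant Z ∧ z ∈ Z := by
    refine Submodule.iSup_induction _ (motive := fun z =>
      ∃ Z, (shiftRep n T Q).IsFinInvariant Z ∧ z ∈ Z) hz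
      (fun μ y hy => ⟨_, isFinInvariant_eigenspace_gram, hy⟩)
      ⟨⊥, IsometryRep.isFinInvariant_bot, Submodule.zero_mem _⟩ ?_
    rintro y w ⟨Y, hY, hy⟩ ⟨W, hW, hw⟩
    exact ⟨Y ⊔ W, hY.sup hW, Submodule.add_mem_sup hy hw⟩
  obtain ⟨Z, hZ, hzZ⟩ := hfin
  exact ⟨Z, hZ, z, hzZ, hxz⟩

end GramRotSpace

/-! ### The index -/

variable {n : ℕ} {T : ℝ} {Q : Matrix.orthogonalGroup (Fin n) ℝ}

/-- Each coordinate of `Φ` is multiplied, along orbits that start in `Γ`, by `exp (i ω s)` for a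
frequency `ω` of that coordinate. -/
def RotatesOn {k : ℕ} (Γ : Set (RotSpace n T Q)) (Φ : RotSpace n T Q → Fin k → ℂ) : Prop :=
  ∀ l : Fin k, ∃ ω ∈ frequencies T Q, ∀ s : ℝ, ∀ x ∈ Γ,
    Φ (shift s x) l = Complex.exp (Complex.I * ω * s) * Φ x l

theorem norm_exp_I_mul_mul (ω s : ℝ) : ‖Complex.exp (Complex.I * ω * s)‖ = 1 := by
  rw [Complex.norm_exp]
  simp

theorem RotatesOn.norm_apply_shift {k : ℕ} {Γ : Set (RotSpace n T Q)}
    {Φ : RotSpace n T Q → Fin k → ℂ} (h : RotatesOn Γ Φ) {x : RotSpace n T Q} (hx : x ∈ Γ)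
    (s : ℝ) : ‖Φ (shift s x)‖ = ‖Φ x‖ := by
  have h1 : ∀ l, ‖Φ (shift s x) l‖₊ = ‖Φ x l‖₊ := fun l => by
    obtain ⟨ω, -, hω⟩ := h l
    rw [hω s x hx, nnnorm_mul]
    have : ‖Complex.exp (Complex.I * ω * s)‖₊ = 1 := NNReal.eq (norm_exp_I_mul_mul ω s)
    rw [this, one_mul]
  simp only [Pi.norm_def, h1]

variable [hT : Fact (0 < T)]

theorem hasIndexMap_empty : HasIndexMap (∅ : Set (RotSpace n T Q)) 0 :=
  ⟨fun _ l => l.elim0, continuousOn_empty _, fun _ h => h.elim, fun l => l.elim0⟩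

theorem ind_le {Γ : Set (RotSpace n T Q)} {k : ℕ} (h : HasIndexMap Γ k) : ind Γ ≤ k :=
  sInf_le ⟨k, rfl, h⟩

theorem le_ind {Γ : Set (RotSpace n T Q)} {k : ℕ} (h : ∀ m, HasIndexMap Γ m → k ≤ m) :
    (k : ℕ∞) ≤ ind Γ := by
  refine le_sInf ?_
  rintro _ ⟨m, rfl, hm⟩
  exact_mod_cast h m hm

/-- Subadditivity of the index: an index map on `{x ∈ Γ | ‖Ψ x‖ ≤ r}`, cut off before `‖Ψ‖` reaches
`r`, is completed by `Ψ` to an index map on `Γ`. -/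
theorem HasIndexMap.add {i k : ℕ} {Γ : Set (RotSpace n T Q)} {Ψ : RotSpace n T Q → Fin k → ℂ}
    (hΨ : ContinuousOn Ψ Γ) (hΨr : RotatesOn Γ Ψ) {r : ℝ} (hr : 0 < r)
    (h : HasIndexMap {x ∈ Γ | ‖Ψ x‖ ≤ r} i) : HasIndexMap Γ (i + k) := by
  obtain ⟨Φ, hΦ, hΦ0, hΦr⟩ := h
  set ρ : RotSpace n T Q → ℝ := fun x => max 0 (r / 2 - ‖Ψ x‖) with hρ
  have hρc : ContinuousOn ρ Γ := continuousOn_const.sup (continuousOn_const.sub hΨ.norm)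
  have hρ0 : ∀ x, r / 2 ≤ ‖Ψ x‖ → ρ x = 0 := fun x hx => max_eq_left (by linarith)
  have hc : ContinuousOn (fun x => ρ x • Φ x) Γ := by
    intro x hx
    rcases lt_or_ge ‖Ψ x‖ r with hlt | hge
    · have hev : ∀ᶠ y in 𝓝[Γ] x, ‖Ψ y‖ < r := (hΨ.norm x hx).eventually_lt_const hlt
      have hnhds : {y ∈ Γ | ‖Ψ y‖ ≤ r} ∈ 𝓝[Γ] x := by
        filter_upwards [hev, self_mem_nhdsWithin] with y hy hyΓ using ⟨hyΓ, hy.le⟩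
      exact (hρc x hx).smul
        ((hΦ x ⟨hx, hlt.le⟩).mono_of_mem_nhdsWithin hnhds)
    · have hev : ∀ᶠ y in 𝓝[Γ] x, r / 2 < ‖Ψ y‖ :=
        (hΨ.norm x hx).eventually_const_lt (by linarith)
      have hx0 : ρ x • Φ x = 0 := by rw [hρ0 x (by linarith), zero_smul]
      rw [ContinuousWithinAt, hx0]
      refine tendsto_const_nhds.congr' ?_
      filter_upwards [hev] with y hy
      rw [hρ0 y hy.le, zero_smul]
  refine ⟨fun x => Fin.append (ρ x • Φ x) (Ψ x), ?_, fun x hx hzero => ?_, fun l => ?_⟩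
  · refine continuousOn_pi.2 fun l => ?_
    induction l using Fin.addCases with
    | left l => simpa only [Fin.append_left] using continuousOn_pi.1 hc l
    | right l => simpa only [Fin.append_right] using continuousOn_pi.1 hΨ l
  · have hΨ0 : Ψ x = 0 := funext fun l => by
      have h1 : Fin.append (ρ x • Φ x) (Ψ x) (Fin.natAdd i l) = 0 :=
        congrFun hzero (Fin.natAdd i l)
      rwa [Fin.append_right] at h1
    have hn : ‖Ψ x‖ = 0 := by rw [hΨ0, norm_zero]
    have hρx : ρ x ≠ 0 := by
      have : ρ x = r / 2 := by
        simp only [hρ, hn, sub_zero]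
        exact max_eq_right (by linarith)
      rw [this]
      positivity
    refine hΦ0 x ⟨hx, by linarith⟩ (funext fun l => ?_)
    have h1 : Fin.append (ρ x • Φ x) (Ψ x) (Fin.castAdd k l) = 0 :=
      congrFun hzero (Fin.castAdd k l)
    rw [Fin.append_left] at h1
    exact (smul_eq_zero.1 h1).resolve_left hρx
  · induction l using Fin.addCases with
    | left l =>
      obtain ⟨ω, hω, hωr⟩ := hΦr l
      refine ⟨ω, hω, fun s x hx => ?_⟩
      simp only [Fin.append_left, Pi.smul_apply]
      have hρs : ρ (shift s x) = ρ x := by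
        simp only [hρ, hΨr.norm_apply_shift hx]
      rw [hρs]
      rcases le_or_gt ‖Ψ x‖ r with hle | hgt
      · rw [hωr s x ⟨hx, hle⟩, mul_smul_comm]
      · rw [hρ0 x (by linarith), zero_smul, zero_smul, mul_zero]
    | right l =>
      obtain ⟨ω, hω, hωr⟩ := hΨr l
      refine ⟨ω, hω, fun s x hx => ?_⟩
      simpa only [Fin.append_right] using hωr s x hx

/-- The action of `ℝ` on `ℂ` by the rotations `exp (i ω s)`. -/
def rotationRep (ω : ℝ) : IsometryRep ℂ where
  map s := (rotation (Circle.exp (ω * s))).toLinearIsometry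
  map_zero z := by simp
  map_add s t z := by simp [mul_add, Circle.exp_add, mul_assoc]
  continuous_orbit z := by
    have : Continuous fun s : ℝ => (Circle.exp (ω * s) : ℂ) * z := by fun_prop
    exact this

theorem rotationRep_apply (ω s : ℝ) (z : ℂ) :
    rotationRep ω s z = Complex.exp (Complex.I * ω * s) * z := by
  change (Circle.exp (ω * s) : ℂ) * z = _
  rw [Circle.coe_exp]
  congr 2
  push_cast
  ring

/-- An index map on a compact invariant set can be replaced by one that is the restriction of an
equivariant Lipschitz map on the whole space. -/
theorem exists_lipschitz_rotatesOn {K : Set (RotSpace n T Q)} (hK : IsCompact K)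
    (hKi : IsInvariant K) {k : ℕ} (h : HasIndexMap K k) :
    ∃ (Ψ : RotSpace n T Q → Fin k → ℂ) (C : NNReal) (m : ℝ), LipschitzWith C Ψ ∧
      RotatesOn Set.univ Ψ ∧ 0 < m ∧ ∀ x ∈ K, 4 * m ≤ ‖Ψ x‖ := by
  obtain ⟨Φ, hΦ, hΦ0, hΦr⟩ := h
  obtain ⟨a, ha, haK⟩ := hK.exists_forall_le' hΦ.norm (a := 0) fun x hx =>
    norm_pos_iff.2 (hΦ0 x hx)
  have hcoord : ∀ l : Fin k, ∃ (ψ : RotSpace n T Q → ℂ) (C : NNReal), LipschitzWith C ψ ∧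
      (∃ ω ∈ frequencies T Q, ∀ s x, ψ (shift s x) = Complex.exp (Complex.I * ω * s) * ψ x) ∧
      ∀ x ∈ K, ‖ψ x - Φ x l‖ ≤ a / 2 := by
    intro l
    obtain ⟨ω, hω, hωr⟩ := hΦr l
    have hc : ContinuousOn (fun x => Φ x l) K := continuousOn_pi.1 hΦ l
    obtain ⟨M, hM⟩ := hK.exists_bound_of_continuousOn hc
    obtain ⟨ψ, C, hψ, hψe, hψa⟩ := exists_equivariant_lipschitz_approx
      (shiftRep n T Q) (rotationRep ω) (O := K) hKi (f := fun x => Φ x l)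
      (fun s x hx => by rw [rotationRep_apply]; exact hωr s x hx) hM
      (hK.uniformContinuousOn_of_continuous hc) (half_pos ha)
    exact ⟨ψ, C, hψ, ⟨ω, hω, fun s x => (hψe s x).trans (rotationRep_apply ω s _)⟩, hψa⟩
  choose ψ C hψ hψe hψa using hcoord
  refine ⟨fun x l => ψ l x, ∑ l, C l, a / 8, ?_, fun l => ?_, by positivity, fun x hx => ?_⟩
  · refine LipschitzWith.of_dist_le_mul fun x y => (dist_pi_le_iff (by positivity)).2 fun l => ?_
    refine ((hψ l).dist_le_mul x y).trans ?_
    gcongr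
    exact Finset.single_le_sum (f := C) (fun _ _ => zero_le) (Finset.mem_univ l)
  · obtain ⟨ω, hω, hωr⟩ := hψe l
    exact ⟨ω, hω, fun s x _ => hωr s x⟩
  · have h1 : ‖Φ x - fun l => ψ l x‖ ≤ a / 2 :=
      (pi_norm_le_iff_of_nonneg (by positivity)).2 fun l => by
        rw [Pi.sub_apply, norm_sub_rev]
        exact hψa l x hx
    have h2 := haK x hx
    have h3 := norm_sub_norm_le (Φ x) fun l => ψ l x
    linarith

/-! ### Deforming minimax sets past a critical level -/

section Critical

variable {E : RotSpace n T Q → ℝ} {c : ℝ}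

theorem PalaisSmale.isCompact_criticalSet (hPS : PalaisSmale E) (hE : ContDiff ℝ 1 E) :
    IsCompact (criticalSet E c) := by
  refine IsSeqCompact.isCompact fun u hu => ?_
  obtain ⟨x, φ, hφ, hx⟩ := hPS u ⟨|c|, fun k => by rw [(hu k).2]⟩
    (by simp only [(hu _).1]; exact tendsto_const_nhds)
  refine ⟨x, ?_, φ, hφ, hx⟩
  have hcl : IsClosed (criticalSet E c) :=
    (isClosed_eq (hE.continuous_fderiv one_ne_zero) continuous_const).inter
      (isClosed_eq hE.continuous continuous_const)
  exact hcl.mem_of_tendsto hx (Eventually.of_forall fun k => hu _)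

theorem isInvariant_criticalSet (hE : ContDiff ℝ 1 E) (hinv : ∀ s x, E (shift s x) = E x) :
    IsInvariant (criticalSet E c) := fun s x hx =>
  ⟨by
    refine ContinuousLinearMap.ext fun v => ?_
    have h := IsometryRep.fderiv_map (σ := shiftRep n T Q) (hE.differentiable one_ne_zero) hinv
      s x (shift (-s) v)
    rw [shiftRep_apply, shiftRep_apply, ← shift_add, add_neg_cancel, shift_zero, hx.1] at h
    exact h, (hinv s x).trans hx.2⟩

/-- Away from the critical set, the derivative is bounded below near the critical level. -/
theorem PalaisSmale.exists_le_norm_fderiv (hPS : PalaisSmale E) (hE : ContDiff ℝ 1 E)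
    {S : Set (RotSpace n T Q)} (hS : IsClosed S) (hSK : Disjoint S (criticalSet E c)) :
    ∃ δ > 0, ∀ x ∈ S, |E x - c| ≤ δ → δ ≤ ‖fderiv ℝ E x‖ := by
  by_contra! hcon
  choose u huS huE hud using fun k : ℕ => hcon (1 / (k + 1 : ℝ)) (by positivity)
  have h0 : Tendsto (fun k : ℕ => 1 / (k + 1 : ℝ)) atTop (𝓝 0) :=
    tendsto_one_div_add_atTop_nhds_zero_nat
  have hd : Tendsto (fun k => fderiv ℝ E (u k)) atTop (𝓝 0) :=
    squeeze_zero_norm (E := RotSpace n T Q →L[ℝ] ℝ) (fun k => (hud k).le) h0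
  have hEu : Tendsto (fun k => E (u k)) atTop (𝓝 c) := by
    rw [tendsto_iff_norm_sub_tendsto_zero]
    exact squeeze_zero (fun k => norm_nonneg _) huE h0
  obtain ⟨x, φ, hφ, hx⟩ := hPS u ⟨|c| + 1, fun k => by
    have h1 := huE k
    have h2 : 1 / (k + 1 : ℝ) ≤ 1 := by
      rw [div_le_one (by positivity)]
      linarith [(Nat.cast_nonneg k : (0 : ℝ) ≤ k)]
    have h3 := abs_sub_abs_le_abs_sub (E (u k)) c
    linarith⟩ hd
  refine Set.disjoint_left.1 hSK (hS.mem_of_tendsto hx (Eventually.of_forall fun k => huS _))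
    ⟨?_, ?_⟩
  · exact tendsto_nhds_unique (((hE.continuous_fderiv one_ne_zero).tendsto x).comp hx)
      (hd.comp hφ.tendsto_atTop)
  · exact tendsto_nhds_unique ((hE.continuous.tendsto x).comp hx) (hEu.comp hφ.tendsto_atTop)

/-- The class `𝔅` is stable under composition on the right with a homeomorphism that preserves,
up to agreement on compact sets, all large finite dimensional invariant subspaces. -/
theorem trans_mem_classB {h g : RotSpace n T Q ≃ₜ RotSpace n T Q}
    (he : ∀ s x, h (shift s x) = shift s (h x)) (h0 : h 0 = 0)
    (hfin : ∀ (Y : Submodule ℝ (RotSpace n T Q)) (Γ : Set (RotSpace n T Q)),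
      (shiftRep n T Q).IsFinInvariant Y → IsCompact Γ → Γ ⊆ Y →
        ∃ Z, (shiftRep n T Q).IsFinInvariant Z ∧ Y ≤ Z ∧
          ∀ Z', (shiftRep n T Q).IsFinInvariant Z' → Z ≤ Z' →
            ∃ k : Z' ≃ₜ Z', (∀ (s : ℝ) (z w : Z'), (w : RotSpace n T Q) = shiftRep n T Q s z →
              (k w : RotSpace n T Q) = shiftRep n T Q s (k z)) ∧
              ∀ z : Z', (z : RotSpace n T Q) ∈ Γ → h z = k z)
    (hg : g ∈ classB n T Q) : h.trans g ∈ classB n T Q := by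
  obtain ⟨hge, hg0, hgB⟩ := hg
  refine ⟨fun s x => ?_, ?_, fun Y Γ ε hYf hYi hΓ hΓY hε => ?_⟩
  · simp only [Homeomorph.trans_apply, he, hge]
  · simp only [Homeomorph.trans_apply, h0, hg0]
  obtain ⟨Z, hZ, hYZ, hZk⟩ := hfin Y Γ ⟨hYf, hYi⟩ hΓ hΓY
  have hsub : h '' Γ ⊆ Z := by
    obtain ⟨k, -, hk⟩ := hZk Z hZ le_rfl
    rintro _ ⟨x, hx, rfl⟩
    rw [hk ⟨x, hYZ (hΓY hx)⟩ hx]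
    exact (k _).2
  obtain ⟨W, q, hWf, hWi, hZW, hqe, hq⟩ :=
    hgB Z (h '' Γ) ε hZ.1 hZ.2 (hΓ.image h.continuous) hsub hε
  obtain ⟨k, hke, hk⟩ := hZk W ⟨hWf, hWi⟩ hZW
  refine ⟨W, k.trans q, hWf, hWi, hYZ.trans hZW, fun s z w hw => ?_, fun z hz => ?_⟩
  · exact hqe s (k z) (k w) (hke s z w hw)
  · have h1 := hk z hz
    have h2 := hq (k z) ⟨z, hz, h1⟩
    rw [← h1] at h2
    exact h2

/-- If the critical set at the level `c = cⱼ` has an index map with `k ≤ j - i` coordinates, then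
`cᵢ < c`: remove from an almost optimal set for `cⱼ` a neighbourhood of the critical set on which
the index map survives, and deform the rest below the level `c`. -/
theorem minimax_lt_of_hasIndexMap (hE : ContDiff ℝ 1 E) (hinv : ∀ s x, E (shift s x) = E x)
    (hPS : PalaisSmale E) {i j k : ℕ} (hc : minimax E j = (c : EReal)) (h0 : E 0 ≠ c)
    (hk : HasIndexMap (criticalSet E c) k) (hijk : i + k ≤ j) : minimax E i < c := by
  obtain ⟨Ψ, C, m, hΨ, hΨr, hm, hΨm⟩ := exists_lipschitz_rotatesOn
    (hPS.isCompact_criticalSet hE) (isInvariant_criticalSet hE hinv) hk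
  obtain ⟨δ, hδ, hδE⟩ := hPS.exists_le_norm_fderiv hE (c := c) (S := {x | ‖Ψ x‖ ≤ 3 * m})
    (isClosed_le hΨ.continuous.norm continuous_const)
    (Set.disjoint_left.2 fun x hx hxK => by
      have h1 := hΨm x hxK
      have h2 : ‖Ψ x‖ ≤ 3 * m := hx
      linarith)
  have h0c : 0 < |E 0 - c| := abs_pos.2 (sub_ne_zero.2 h0)
  set b := min δ (|E 0 - c| / 2) with hb
  have hb0 : 0 < b := lt_min hδ (by positivity)
  set F : Set (RotSpace n T Q) := {x | |E x - c| ≤ b ∧ ‖Ψ x‖ ≤ 3 * m} with hF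
  have hFcl : IsClosed F :=
    (isClosed_le (hE.continuous.sub continuous_const).abs continuous_const).inter
      (isClosed_le hΨ.continuous.norm continuous_const)
  have hFi : (shiftRep n T Q).Invariant F := fun s x hx => by
    refine ⟨?_, ?_⟩
    · rw [shiftRep_apply, hinv]
      exact hx.1
    · rw [shiftRep_apply, hΨr.norm_apply_shift (Set.mem_univ x)]
      exact hx.2
  have h0F : (0 : RotSpace n T Q) ∉ F := fun h => by
    have h1 : |E 0 - c| ≤ |E 0 - c| / 2 := h.1.trans (min_le_right _ _)
    linarith
  -- The flow has speed at most `1`, so in time `τ` it does not leave `‖Ψ‖ ≤ 3 m`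
  -- when it starts in `‖Ψ‖ ≤ 2 m`.
  set τ := min 1 (m / (C + 1)) with hτ
  have hτ0 : 0 < τ := lt_min one_pos (by positivity)
  have hτC : C * τ ≤ m := by
    have h1 : τ * (C + 1) ≤ m := by
      rw [← le_div_iff₀ (by positivity)]
      exact min_le_right _ _
    nlinarith
  have hτ1 : τ ≤ 1 := min_le_left _ _
  -- The deformation descends by `b τ / 2 = 2 ε`, and the strip it has to cross from below `c + ε`
  -- stays within `3 ε ≤ b` of the level `c`.
  set ε := b * τ / 4 with hε
  have hε0 : 0 < ε := by positivity
  have hεb : 3 * ε ≤ b := by nlinarith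
  obtain ⟨h, he, hh0, hhE, hhd, hfin⟩ := IsometryRep.exists_deformation
    hasDenseFinInvariant_shiftRep hE hinv hFcl hFi h0F hb0
    (fun x hx => (min_le_left _ _).trans (hδE x hx.2 (hx.1.trans (min_le_left _ _)))) hτ0.le
  obtain ⟨A, hA, hAE⟩ : ∃ A ∈ classA n T Q j, ⨆ x ∈ A, (E x : EReal) < ((c + ε : ℝ) : EReal) := by
    have h1 : minimax E j < ((c + ε : ℝ) : EReal) := by
      rw [hc]
      exact_mod_cast lt_add_of_pos_right c hε0
    simpa only [minimax, iInf_lt_iff, exists_prop] using h1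
  have hAE' : ∀ x ∈ A, E x < c + ε := fun x hx => by
    have h1 : (E x : EReal) ≤ ⨆ x ∈ A, (E x : EReal) :=
      le_iSup₂ (f := fun x _ => (E x : EReal)) x hx
    exact_mod_cast h1.trans_lt hAE
  set A' : Set (RotSpace n T Q) := {x ∈ A | ‖Ψ x‖ ≤ 2 * m} with hA'
  have hdown : ∀ x ∈ A', E (h x) ≤ c - ε := by
    rintro x ⟨hxA, hxΨ⟩
    rcases le_or_gt (E x) (c - ε) with hle | hgt
    · exact (hhE x).trans hle
    · have h1 := hAE' x hxA
      have h2 : b * τ / 2 = 2 * ε := by rw [hε]; ring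
      have h3 := hhd x fun y hyx hyl hyu => by
        rw [h2] at hyl
        refine ⟨(abs_le.2 ⟨by linarith, by linarith⟩ : |E y - c| ≤ b), ?_⟩
        have h4 := hΨ.dist_le_mul y x
        rw [dist_eq_norm, dist_eq_norm] at h4
        have h5 : C * ‖y - x‖ ≤ C * τ := by gcongr
        have h6 := norm_sub_norm_le (Ψ y) (Ψ x)
        linarith
      rw [h2] at h3
      linarith
  have hmem : h '' A' ∈ classA n T Q i := by
    refine ⟨?_, fun g hg => le_ind fun i' hi' => ?_⟩
    · rintro s _ ⟨x, hx, rfl⟩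
      refine ⟨shift s x, ⟨hA.1 s x hx.1, ?_⟩, he s x⟩
      rw [hΨr.norm_apply_shift (Set.mem_univ x)]
      exact hx.2
    · have hf := trans_mem_classB he hh0 hfin hg
      set f := h.trans g with hfdef
      have hfs : ∀ s x, f.symm (shift s x) = shift s (f.symm x) := fun s x => by
        rw [Homeomorph.symm_apply_eq, hf.1, Homeomorph.apply_symm_apply]
      have hset : {y ∈ f '' A ∩ meanZero n T Q | ‖Ψ (f.symm y)‖ ≤ 2 * m} =
          g '' (h '' A') ∩ meanZero n T Q := by
        ext y
        constructor
        · rintro ⟨⟨⟨x, hx, rfl⟩, hy⟩, hyΨ⟩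
          rw [Homeomorph.symm_apply_apply] at hyΨ
          exact ⟨⟨h x, ⟨x, ⟨hx, hyΨ⟩, rfl⟩, rfl⟩, hy⟩
        · rintro ⟨⟨_, ⟨x, hx, rfl⟩, rfl⟩, hy⟩
          refine ⟨⟨⟨x, hx.1, rfl⟩, hy⟩, ?_⟩
          rw [show g (h x) = f x from rfl, Homeomorph.symm_apply_apply]
          exact hx.2
      rw [← hset] at hi'
      -- An index map with `i'` coordinates on the deformed part yields one with `i' + k`
      -- coordinates on `f '' A ∩ X̂`, which has index at least `j`.
      have h1 : HasIndexMap (f '' A ∩ meanZero n T Q) (i' + k) := by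
        refine HasIndexMap.add (Ψ := fun y => Ψ (f.symm y))
          (hΨ.continuous.comp f.symm.continuous).continuousOn (fun l => ?_) (by positivity) hi'
        obtain ⟨ω, hω, hωr⟩ := hΨr l
        exact ⟨ω, hω, fun s x _ => by
          simpa only [hfs] using hωr s (f.symm x) (Set.mem_univ _)⟩
      have h2 : (j : ℕ∞) ≤ ((i' + k : ℕ) : ℕ∞) := (hA.2 f hf).trans (ind_le h1)
      have h3 : j ≤ i' + k := by exact_mod_cast h2
      omega
  have hle : minimax E i ≤ ((c - ε : ℝ) : EReal) := by
    refine (iInf₂_le _ hmem).trans (iSup₂_le ?_)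
    rintro _ ⟨x, hx, rfl⟩
    exact_mod_cast hdown x hx
  refine hle.trans_lt ?_
  exact_mod_cast sub_lt_self c hε0

end Critical

end RotatingOrbits

end

theorem theorem3 (n : ℕ) (T : ℝ) [Fact (0 < T)] (Q : Matrix.orthogonalGroup (Fin n) ℝ)
    (E : RotatingOrbits.RotSpace n T Q → ℝ) (hE : ContDiff ℝ 1 E)
    (hinv : ∀ (s : ℝ) (x : RotatingOrbits.RotSpace n T Q), E (RotatingOrbits.shift s x) = E x)
    (hPS : RotatingOrbits.PalaisSmale E)
    (j : ℕ) (hj : 1 ≤ j) (c : ℝ) (hc : RotatingOrbits.minimax E j = (c : EReal))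
    (hfix : RotatingOrbits.criticalSet E c ∩ RotatingOrbits.fixedPoints n T Q = ∅)
    (h0 : E 0 ≠ c) :
    (∃ x, fderiv ℝ E x = 0 ∧ E x = c) ∧
      ∀ i : ℕ, 1 ≤ i → i ≤ j → RotatingOrbits.minimax E i = RotatingOrbits.minimax E j →
        ((j - i + 1 : ℕ) : ℕ∞) ≤ RotatingOrbits.ind (RotatingOrbits.criticalSet E c) := by
  constructor
  · by_contra hno
    have hempty : RotatingOrbits.criticalSet E c = ∅ :=
      Set.eq_empty_of_forall_notMem fun x hx => hno ⟨x, hx⟩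
    have hlt := RotatingOrbits.minimax_lt_of_hasIndexMap (i := j) (k := 0) hE hinv hPS hc h0
      (by rw [hempty]; exact RotatingOrbits.hasIndexMap_empty) le_rfl
    exact hlt.ne hc
  · intro i _ hij hcc
    refine RotatingOrbits.le_ind fun k hk => ?_
    by_contra hlt
    exact (RotatingOrbits.minimax_lt_of_hasIndexMap (i := i) hE hinv hPS hc h0 hk
      (by omega)).ne (hcc.trans hc)
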